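/- Let $u_0\in C^\infty([0,1])$ satisfy $u_0(0)=u_0(1)=0$, and suppose that $M_0:=\max_{[0,1]}u_0'>0$ is attained exactly at finitely many points $\overline\alpha_1,\dots,\overline\alpha_n\in[0,1]$, with $u_0''(\overline\alpha_i)\neq0$ for every $i$ (derivatives at $0$ and $1$ are one-sided). Consider the problem $$u_{xt}+uu_{xx}-u_x^2=-2\int_0^1u_x^2\,dx,\qquad u(x,0)=u_0(x),\qquad u(0,t)=u(1,t)=0,\qquad x\in[0,1].\tag{1}$$ Then every $\overline\alpha_i$ is a boundary point, $\overline\alpha_i\in\{0,1\}$, and there is a finite $t_*>0$ such that (1) has a solution $u\in C^\infty([0,1]\times[0,t_*))$; moreover every smooth solution of (1) on $[0,1]\times[0,T)$ has $T\le t_*$ and coincides with $u$ there. As $t\uparrow t_*$, $u_x$ blows up: $\|u_x(\cdot,t)\|_{L^\infty[0,1]}\to\infty$. More precisely, let $\gamma$ be the flow of $u$, that is, $\partial_t\gamma(\alpha,t)=u(\gamma(\alpha,t),t)$, $\gamma(\alpha,0)=\alpha$, for $\alpha\in[0,1]$ and $t\in[0,t_*)$. Let $\eta(t)=\int_0^t\varphi(s)^{-2}\,ds$,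 where $\varphi$ solves $\ddot\varphi=2\left(\int_0^1u_x^2\,dx\right)\varphi$, $\varphi(0)=1$, $\dot\varphi(0)=0$. Put $\eta_*=1/M_0$ and $S=\sum_{i=1}^n 1/|u_0''(\overline\alpha_i)|$. Then $0\le\eta<\eta_*$ on $[0,t_*)$, $\eta(t)\to\eta_*$ as $t\uparrow t_*$, and the following hold, where $f\sim g$ means $f/g\to1$ as $t\uparrow t_*$. 1. For every $i$ and every $t\in[0,t_*)$, $\gamma(\overline\alpha_i,t)=\overline\alpha_i$ and $\max_{\alpha\in[0,1]}u_x(\gamma(\alpha,t),t)=u_x(\overline\alpha_i,t)$. Moreover $u_x(\overline\alpha_i,t)\to+\infty$ as $t\uparrow t_*$, with $$u_x(\overline\alpha_i,t)\sim\frac{1}{(M_0S)^2}\,\frac{1}{(\eta_*-\eta(t))\ln^2(\eta_*-\eta(t))}.$$ 2. For every $\alpha\in[0,1]\setminus\{\overline\alpha_1,\dots,\overline\alpha_n\}$, $u_x(\gamma(\alpha,t),t)\to-\infty$ as $t\uparrow t_*$, with $$u_x(\gamma(\alpha,t),t)\sim\frac{1}{(M_0S)^2}\,\frac{1}{(\eta_*-\eta(t))\ln^3(\eta_*-\eta(t))}.$$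 3. $$t_*-t\sim(M_0S)^2\int_{\eta(t)}^{\eta_*}\ln^2(\eta_*-\mu)\,d\mu.$$ -/

import Mathlib

open Set Filter Topology MeasureTheory Asymptotics
open scoped ContDiff ENNReal

namespace NonlocalBlowup

/-- The derivative on `[0,1]` of a function of one variable (one-sided at the endpoints). -/
noncomputable def dI (f : ℝ → ℝ) : ℝ → ℝ := derivWithin f (Icc 0 1)

/-- The space derivative `u_x(x,t)`, for `x ∈ [0,1]`. -/
noncomputable def ux (u : ℝ → ℝ → ℝ) (x t : ℝ) : ℝ := dI (fun y => u y t) x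

/-- The second space derivative `u_xx(x,t)`, for `x ∈ [0,1]`. -/
noncomputable def uxx (u : ℝ → ℝ → ℝ) (x t : ℝ) : ℝ := dI (fun y => ux u y t) x

/-- The mixed derivative `u_xt(x,t)`. -/
noncomputable def uxt (u : ℝ → ℝ → ℝ) (x t : ℝ) : ℝ := deriv (fun s => ux u x s) t

/-- `u` is a smooth solution on `[0,1] × [0,T)` (smooth up to the boundary and up to `t = 0`) of
`u_xt + u u_xx - u_x² = -2 ∫₀¹ u_x² dx` with initial data `u₀` and Dirichlet boundary conditions. -/
structure IsSmoothSolution (u₀ : ℝ → ℝ) (T : ℝ) (u : ℝ → ℝ → ℝ) : Prop where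
  smooth : ContDiffOn ℝ ∞ (fun p : ℝ × ℝ => u p.1 p.2) (Icc 0 1 ×ˢ Ico 0 T)
  equation : ∀ x ∈ Icc (0 : ℝ) 1, ∀ t ∈ Ioo 0 T,
    uxt u x t + u x t * uxx u x t - ux u x t ^ 2 = -2 * ∫ y in (0 : ℝ)..1, ux u y t ^ 2
  initial : ∀ x ∈ Icc (0 : ℝ) 1, u x 0 = u₀ x
  boundary : ∀ t ∈ Ico 0 T, u 0 t = 0 ∧ u 1 t = 0

/-- `γ` is the flow of `u` on `[0,1] × [0,T)`: `∂γ/∂t = u(γ,t)`, `γ(α,0) = α`. -/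
structure IsFlow (T : ℝ) (u γ : ℝ → ℝ → ℝ) : Prop where
  initial : ∀ α ∈ Icc (0 : ℝ) 1, γ α 0 = α
  mem : ∀ α ∈ Icc (0 : ℝ) 1, ∀ t ∈ Ico 0 T, γ α t ∈ Icc (0 : ℝ) 1
  ode : ∀ α ∈ Icc (0 : ℝ) 1, ∀ t ∈ Ico 0 T,
    HasDerivWithinAt (γ α) (u (γ α t) t) (Ico 0 T) t

/-- `η` is the rescaled time attached to `u` on `[0,T)`: `η(t) = ∫₀ᵗ φ(s)⁻² ds`, where `φ` solves
`φ'' = 2 (∫₀¹ u_x² dx) φ`, `φ(0) = 1`, `φ'(0) = 0`. (Such a `φ` is unique and satisfies `φ ≥ 1`.) -/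
def IsRescaledTime (T : ℝ) (u : ℝ → ℝ → ℝ) (η : ℝ → ℝ) : Prop :=
  ∃ φ ψ : ℝ → ℝ, φ 0 = 1 ∧ ψ 0 = 0 ∧
    (∀ t ∈ Ico 0 T, HasDerivWithinAt φ (ψ t) (Ico 0 T) t) ∧
    (∀ t ∈ Ico 0 T,
      HasDerivWithinAt ψ ((2 * ∫ y in (0 : ℝ)..1, ux u y t ^ 2) * φ t) (Ico 0 T) t) ∧
    ∀ t ∈ Ico 0 T, η t = ∫ s in (0 : ℝ)..t, (φ s ^ 2)⁻¹

end NonlocalBlowup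

/-! The problem is solved in closed form in rescaled time. Along trajectories `u_xt + u u_xx` is the
material derivative of `u_x`, so the equation is a Riccati equation forced by a function of `t`
alone. Linearising it makes the Jacobian of the flow proportional to `1 / (1 - η u₀'(α))`, and the
condition that the flow maps `[0,1]` onto itself fixes the factor. Write `H = u₀'` and `K_k(η) = G H
k 1 η`. Then `flow` is the trajectory map, `K_0` is `φ`, time satisfies `dt = K_0² dη`, and along a
trajectory with `h = H α` one has `u_x = (h / (1 - η h) - K_1 / K_0) / K_0²`
(`IsClock.ux_sol_flow`).

Everything then reduces to the behaviour of `K_0` and `K_1` as `η` increases to `1 / M₀`. At an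
interior maximum `u₀''` would vanish, so the maxima sit at endpoints, where `u₀'` leaves `M₀`
linearly with slope of size `|u₀''|`. Comparison with affine denominators gives, with `ε = 1 / M₀ -
η`, `K_0 ~ M₀ S (-ln ε)` and `K_1 ~ M₀ S / ε` (`IsPeaked.tendsto_G_zero`, `IsPeaked.tendsto_G_one`).

Since `ln²` is integrable at `0`, `t_* = ∫ K_0² dη` is finite, and l'Hôpital's rule gives the rate
of `t_* - t` (`IsPeaked.exists_isClock`). At a maximum point the first term of `u_x` equals `1 / ε`
and beats `K_1 / K_0 ~ 1 / (ε |ln ε|)`; on any other trajectory it stays bounded and `-K_1 / K_0³`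
wins. An energy estimate gives uniqueness (`IsSmoothSolution.eqOn`), which together with the blow-up
makes `t_*` maximal. -/

namespace NonlocalBlowup

/-! ### Integrals depending on a parameter -/

/-- Differentiation under the integral sign over a compact interval. -/
lemma hasDerivAt_intervalIntegral_param {f f' : ℝ → ℝ → ℝ} {a b : ℝ} {D : Set ℝ} (hD : IsOpen D)
    (hf : ContinuousOn (fun p : ℝ × ℝ => f p.1 p.2) (uIcc a b ×ˢ D))
    (hf' : ContinuousOn (fun p : ℝ × ℝ => f' p.1 p.2) (uIcc a b ×ˢ D))
    (hd : ∀ s ∈ uIcc a b, ∀ η ∈ D, HasDerivAt (f s) (f' s η) η) {η : ℝ} (hη : η ∈ D) :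
    HasDerivAt (fun x => ∫ s in a..b, f s x) (∫ s in a..b, f' s η) η := by
  obtain ⟨ε, hε, hball⟩ := Metric.nhds_basis_closedBall.mem_iff.1 (hD.mem_nhds hη)
  have hcomp : IsCompact (uIcc a b ×ˢ Metric.closedBall η ε) :=
    isCompact_uIcc.prod (isCompact_closedBall η ε)
  obtain ⟨C, hC⟩ := hcomp.exists_bound_of_continuousOn (hf'.mono (prod_mono le_rfl hball))
  have slice : ∀ {g : ℝ → ℝ → ℝ}, ContinuousOn (fun p : ℝ × ℝ => g p.1 p.2) (uIcc a b ×ˢ D) →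
      ∀ x ∈ D, ContinuousOn (fun s => g s x) (uIcc a b) := fun hg x hx =>
    hg.comp (f := fun s : ℝ => ((s, x) : ℝ × ℝ)) (by fun_prop) fun s hs => ⟨hs, hx⟩
  have meas : ∀ {g : ℝ → ℝ}, ContinuousOn g (uIcc a b) →
      AEStronglyMeasurable g (volume.restrict (uIoc a b)) := fun hg =>
    (hg.mono uIoc_subset_uIcc).aestronglyMeasurable measurableSet_uIoc
  refine (intervalIntegral.hasDerivAt_integral_of_dominated_loc_of_deriv_le
    (F := fun x s => f s x) (F' := fun x s => f' s x) (bound := fun _ => C)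
    (Metric.closedBall_mem_nhds η hε) ?_ (slice hf η hη).intervalIntegrable
    (meas (slice hf' η hη)) ?_ intervalIntegrable_const ?_).2
  · filter_upwards [hD.mem_nhds hη] with x hx using meas (slice hf x hx)
  · exact ae_of_all _ fun s hs x hx => hC (s, x) ⟨uIoc_subset_uIcc hs, hx⟩
  · exact ae_of_all _ fun s hs x hx => hd s (uIoc_subset_uIcc hs) x (hball hx)

lemma continuousOn_intervalIntegral_param {f : ℝ → ℝ → ℝ} {a b : ℝ} (hab : a ≤ b) {D : Set ℝ}
    (hf : ContinuousOn (fun p : ℝ × ℝ => f p.1 p.2) (Icc a b ×ˢ D)) :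
    ContinuousOn (fun x => ∫ s in a..b, f s x) D := by
  rw [continuousOn_iff_continuous_domRestrict]
  -- Clamping `s` to `[a,b]` makes the integrand continuous for every real `s` without changing the
  -- integral.
  have hc : Continuous (Function.uncurry fun (x : D) (s : ℝ) => f (projIcc a b hab s) x) :=
    hf.comp_continuous
      (f := fun p : D × ℝ => (((projIcc a b hab p.2 : ℝ), (p.1 : ℝ)) : ℝ × ℝ))
      (((continuous_subtype_val.comp continuous_projIcc).comp continuous_snd).prodMk
        (continuous_subtype_val.comp continuous_fst))
      fun p => ⟨(projIcc a b hab p.2).2, p.1.2⟩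
  refine (intervalIntegral.continuous_parametric_intervalIntegral_of_continuous' (μ := volume)
    hc a b).congr fun x => ?_
  refine intervalIntegral.integral_congr fun s hs => ?_
  rw [uIcc_of_le hab] at hs
  simp only [projIcc_of_mem hab hs]

/-- A primitive with parameter, `∫₀^α f(s, η) ds`, is strictly differentiable in `(α, η)`. -/
lemma hasStrictFDerivAt_primitive_param {f f' : ℝ → ℝ → ℝ} {D : Set ℝ} (hD : IsOpen D)
    (hf : ContinuousOn (fun p : ℝ × ℝ => f p.1 p.2) (univ ×ˢ D))
    (hf' : ContinuousOn (fun p : ℝ × ℝ => f' p.1 p.2) (univ ×ˢ D))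
    (hd : ∀ s, ∀ η ∈ D, HasDerivAt (f s) (f' s η) η) {α η : ℝ} (hη : η ∈ D) :
    HasStrictFDerivAt (fun p : ℝ × ℝ => ∫ s in (0 : ℝ)..p.1, f s p.2)
      ((f α η) • ContinuousLinearMap.fst ℝ ℝ ℝ +
        (∫ s in (0 : ℝ)..α, f' s η) • ContinuousLinearMap.snd ℝ ℝ ℝ) (α, η) := by
  have slice : ∀ {g : ℝ → ℝ → ℝ}, ContinuousOn (fun p : ℝ × ℝ => g p.1 p.2) (univ ×ˢ D) →
      ∀ x ∈ D, Continuous (fun s => g s x) := fun hg x hx =>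
    hg.comp_continuous (f := fun s : ℝ => ((s, x) : ℝ × ℝ)) (by fun_prop) fun s => ⟨trivial, hx⟩
  have hnhds : (univ : Set ℝ) ×ˢ D ∈ 𝓝 (α, η) := (isOpen_univ.prod hD).mem_nhds ⟨trivial, hη⟩
  have hprim : ContinuousOn (fun p : ℝ × ℝ => ∫ s in (0 : ℝ)..p.1, f' s p.2) (univ ×ˢ D) := by
    rw [continuousOn_iff_continuous_domRestrict]
    have hc : Continuous (Function.uncurry
        fun (x : (univ : Set ℝ) ×ˢ D) (s : ℝ) => f' s (x : ℝ × ℝ).2) :=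
      hf'.comp_continuous
        (f := fun p : ((univ : Set ℝ) ×ˢ D) × ℝ => ((p.2, (p.1 : ℝ × ℝ).2) : ℝ × ℝ))
        (by fun_prop) fun p => ⟨trivial, p.1.2.2⟩
    exact intervalIntegral.continuous_parametric_intervalIntegral_of_continuous (μ := volume) hc
      (s := fun x : (univ : Set ℝ) ×ˢ D => (x : ℝ × ℝ).1) (by fun_prop)
  -- Two continuous partial derivatives give strict differentiability.
  have key := hasStrictFDerivAt_uncurry_coprod (𝕜 := ℝ) (u := ((α, η) : ℝ × ℝ))
    (f := fun a x => ∫ s in (0 : ℝ)..a, f s x)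
    (f₁ := fun a x => (f a x) • ContinuousLinearMap.id ℝ ℝ)
    (f₂ := fun a x => (∫ s in (0 : ℝ)..a, f' s x) • ContinuousLinearMap.id ℝ ℝ) ?_ ?_ ?_ ?_
  · refine HasStrictFDerivAt.congr_fderiv key ?_
    ext <;> simp [Function.HasUncurry.uncurry]
  · filter_upwards [hnhds] with v hv
    have := intervalIntegral.integral_hasDerivAt_right
      ((slice hf v.2 hv.2).intervalIntegrable 0 v.1)
      ((slice hf v.2 hv.2).stronglyMeasurableAtFilter _ _) (slice hf v.2 hv.2).continuousAt
    refine HasFDerivAt.congr_fderiv this.hasFDerivAt ?_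
    ext; simp [Function.HasUncurry.uncurry]
  · filter_upwards [hnhds] with v hv
    have := hasDerivAt_intervalIntegral_param (a := 0) (b := v.1) hD
      (hf.mono (prod_mono (subset_univ _) le_rfl)) (hf'.mono (prod_mono (subset_univ _) le_rfl))
      (fun s _ => hd s) hv.2
    refine HasFDerivAt.congr_fderiv this.hasFDerivAt ?_
    ext; simp [Function.HasUncurry.uncurry]
  · exact (hf.continuousAt hnhds).smul (continuousAt_const (y := ContinuousLinearMap.id ℝ ℝ))
  · exact (hprim.continuousAt hnhds).smul (continuousAt_const (y := ContinuousLinearMap.id ℝ ℝ))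

/-! ### The integrals `∫₀^α h^k / (1 - η h)^(k+1)` -/

/-- `∫₀^α H(s)^k / (1 - η H(s))^(k+1) ds`. -/
noncomputable def G (H : ℝ → ℝ) (k : ℕ) (α η : ℝ) : ℝ :=
  ∫ s in (0 : ℝ)..α, H s ^ k / (1 - η * H s) ^ (k + 1)

section G

variable {H : ℝ → ℝ} {D : Set ℝ}

lemma continuousOn_integrand (hH : Continuous H) (hJ : ∀ η ∈ D, ∀ s, 0 < 1 - η * H s) (k : ℕ) :
    ContinuousOn (fun p : ℝ × ℝ => H p.1 ^ k / (1 - p.2 * H p.1) ^ (k + 1)) (univ ×ˢ D) :=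
  ContinuousOn.div (by fun_prop) (by fun_prop) fun p hp => (pow_pos (hJ p.2 hp.2 p.1) _).ne'

/-- Tying the exponents `k` and `k + 1` together closes the family under `∂/∂η`, which only raises
`k` and produces the factor `k + 1`. -/
lemma hasDerivAt_integrand {x η : ℝ} (hJ : 1 - η * x ≠ 0) (k : ℕ) :
    HasDerivAt (fun η => x ^ k / (1 - η * x) ^ (k + 1))
      ((k + 1) * (x ^ (k + 1) / (1 - η * x) ^ (k + 2))) η := by
  have h1 : HasDerivAt (fun η : ℝ => 1 - η * x) (-x) η := by
    simpa using ((hasDerivAt_id η).mul_const x).const_sub 1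
  have h2 := (hasDerivAt_const η (x ^ k)).div (h1.pow (k + 1)) (pow_ne_zero _ hJ)
  refine h2.congr_deriv ?_
  push_cast
  simp only [Pi.pow_apply]
  field_simp
  ring

lemma G_hasStrictFDerivAt (hH : Continuous H) (hD : IsOpen D)
    (hJ : ∀ η ∈ D, ∀ s, 0 < 1 - η * H s) (k : ℕ) (α : ℝ) {η : ℝ} (hη : η ∈ D) :
    HasStrictFDerivAt (fun p : ℝ × ℝ => G H k p.1 p.2)
      ((H α ^ k / (1 - η * H α) ^ (k + 1)) • ContinuousLinearMap.fst ℝ ℝ ℝ +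
        ((k + 1) * G H (k + 1) α η) • ContinuousLinearMap.snd ℝ ℝ ℝ) (α, η) := by
  have := hasStrictFDerivAt_primitive_param (f := fun s η => H s ^ k / (1 - η * H s) ^ (k + 1))
    (f' := fun s η => (k + 1) * (H s ^ (k + 1) / (1 - η * H s) ^ (k + 2)))
    hD (continuousOn_integrand hH hJ k)
    (continuousOn_const.mul (continuousOn_integrand hH hJ (k + 1)))
    (fun s η hη => hasDerivAt_integrand (hJ η hη s).ne' k) (α := α) hη
  simpa only [G, intervalIntegral.integral_const_mul] using this

lemma G_hasDerivAt_left (hH : Continuous H) (hD : IsOpen D)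
    (hJ : ∀ η ∈ D, ∀ s, 0 < 1 - η * H s) (k : ℕ) (α : ℝ) {η : ℝ} (hη : η ∈ D) :
    HasDerivAt (fun a => G H k a η) (H α ^ k / (1 - η * H α) ^ (k + 1)) α := by
  have := (G_hasStrictFDerivAt hH hD hJ k α hη).hasFDerivAt.comp_hasDerivAt α
    ((hasDerivAt_id α).prodMk (hasDerivAt_const α η))
  exact this.congr_deriv (by simp)

lemma G_hasDerivAt_right (hH : Continuous H) (hD : IsOpen D)
    (hJ : ∀ η ∈ D, ∀ s, 0 < 1 - η * H s) (k : ℕ) (α : ℝ) {η : ℝ} (hη : η ∈ D) :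
    HasDerivAt (fun x => G H k α x) ((k + 1) * G H (k + 1) α η) η := by
  have := (G_hasStrictFDerivAt hH hD hJ k α hη).hasFDerivAt.comp_hasDerivAt η
    ((hasDerivAt_const η α).prodMk (hasDerivAt_id η))
  exact this.congr_deriv (by simp)

lemma uniqueDiffOn_strip {I : Set ℝ} (hI : UniqueDiffOn ℝ I) :
    UniqueDiffOn ℝ (Icc (0 : ℝ) 1 ×ˢ I) :=
  (uniqueDiffOn_Icc one_pos).prod hI

/-- Where `H` is smooth, so are the functions `G H k`. -/
lemma G_contDiffOn (hH : Continuous H) (hHs : ContDiffOn ℝ ∞ H (Icc 0 1)) (hD : IsOpen D)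
    (hJ : ∀ η ∈ D, ∀ s, 0 < 1 - η * H s) (k : ℕ) :
    ContDiffOn ℝ ∞ (fun p : ℝ × ℝ => G H k p.1 p.2) (Icc 0 1 ×ˢ D) := by
  rw [contDiffOn_infty]
  intro n
  -- The derivative of `G H k` involves `G H (k + 1)`, so the induction on the order of smoothness
  -- must run over all `k` at once.
  induction n generalizing k with
  | zero =>
    refine contDiffOn_zero.2 fun p hp => ?_
    exact (G_hasStrictFDerivAt hH hD hJ k p.1 hp.2).hasFDerivAt.continuousAt.continuousWithinAt
  | succ n ih =>
    push_cast
    rw [contDiffOn_succ_iff_hasFDerivWithinAt_of_uniqueDiffOn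
      (uniqueDiffOn_strip hD.uniqueDiffOn)]
    refine ⟨by simp, fun p => (H p.1 ^ k / (1 - p.2 * H p.1) ^ (k + 1)) •
      ContinuousLinearMap.fst ℝ ℝ ℝ + ((k + 1) * G H (k + 1) p.1 p.2) •
      ContinuousLinearMap.snd ℝ ℝ ℝ, ?_, fun p hp =>
      (G_hasStrictFDerivAt hH hD hJ k p.1 hp.2).hasFDerivAt.hasFDerivWithinAt⟩
    have hH1 : ContDiffOn ℝ n (fun p : ℝ × ℝ => H p.1) (Icc 0 1 ×ˢ D) :=
      (hHs.of_le (by exact_mod_cast le_top)).comp contDiffOn_fst fun p hp => hp.1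
    refine ContDiffOn.add (ContDiffOn.smul (ContDiffOn.div (hH1.pow k)
      ((contDiffOn_const.sub (contDiffOn_snd.mul hH1)).pow (k + 1)) fun p hp =>
      (pow_pos (hJ p.2 hp.2 p.1) _).ne') contDiffOn_const)
      (ContDiffOn.smul (contDiffOn_const.mul (ih (k + 1))) contDiffOn_const)

@[simp] lemma G_zero_left (k : ℕ) (η : ℝ) : G H k 0 η = 0 := by simp [G]

end G

end NonlocalBlowup

namespace NonlocalBlowup

/-! ### The flow in the rescaled time -/

/-- A continuous extension `H` of a smooth profile on `[0,1]`, with an open set `D` of rescaled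
times `η` for which `1 - η H` is positive. -/
structure IsProfile (H : ℝ → ℝ) (D : Set ℝ) : Prop where
  continuous : Continuous H
  smooth : ContDiffOn ℝ ∞ H (Icc 0 1)
  isOpen : IsOpen D
  pos : ∀ η ∈ D, ∀ s, 0 < 1 - η * H s

/-- The flow map `∫₀^α (1 - η H)⁻¹ / ∫₀¹ (1 - η H)⁻¹`. -/
noncomputable def flow (H : ℝ → ℝ) (α η : ℝ) : ℝ := G H 0 α η / G H 0 1 η

/-- The derivative of `flow H α η` in `η`. -/
noncomputable def vel (H : ℝ → ℝ) (α η : ℝ) : ℝ :=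
  G H 1 α η / G H 0 1 η - G H 0 α η * G H 1 1 η / G H 0 1 η ^ 2

/-- The inverse of `flow H · η`. -/
noncomputable def back (H : ℝ → ℝ) (x η : ℝ) : ℝ := Function.invFun (fun α => flow H α η) x

lemma hasDerivAt_fst_of_hasFDerivAt {f : ℝ → ℝ → ℝ} {L : ℝ × ℝ →L[ℝ] ℝ} {x y : ℝ}
    (h : HasFDerivAt (fun p : ℝ × ℝ => f p.1 p.2) L (x, y)) :
    HasDerivAt (fun s => f s y) (L (1, 0)) x :=
  h.comp_hasDerivAt x (f := fun s : ℝ => ((s, y) : ℝ × ℝ))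
    ((hasDerivAt_id x).prodMk (hasDerivAt_const x y))

lemma hasDerivAt_snd_of_hasFDerivAt {f : ℝ → ℝ → ℝ} {L : ℝ × ℝ →L[ℝ] ℝ} {x y : ℝ}
    (h : HasFDerivAt (fun p : ℝ × ℝ => f p.1 p.2) L (x, y)) :
    HasDerivAt (fun s => f x s) (L (0, 1)) y :=
  h.comp_hasDerivAt y (f := fun s : ℝ => ((x, s) : ℝ × ℝ))
    ((hasDerivAt_const y x).prodMk (hasDerivAt_id y))

namespace IsProfile

variable {H : ℝ → ℝ} {D : Set ℝ} (P : IsProfile H D)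

include P

lemma G_one_pos {η : ℝ} (hη : η ∈ D) : 0 < G H 0 1 η := by
  refine intervalIntegral.intervalIntegral_pos_of_pos_on ?_ (fun s _ => ?_) one_pos
  · have hc : Continuous fun s => H s ^ 0 / (1 - η * H s) ^ (0 + 1) :=
      Continuous.div (P.continuous.pow 0)
        ((continuous_const.sub (continuous_const.mul P.continuous)).pow _)
        fun s => (pow_pos (P.pos η hη s) _).ne'
    exact hc.intervalIntegrable _ _
  · have := P.pos η hη s
    positivity

lemma hasDerivAt_G_one (k : ℕ) {η : ℝ} (hη : η ∈ D) :
    HasDerivAt (fun x => G H k 1 x) ((k + 1) * G H (k + 1) 1 η) η :=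
  G_hasDerivAt_right P.continuous P.isOpen P.pos k 1 hη

lemma hasStrictFDerivAt_flow (α : ℝ) {η : ℝ} (hη : η ∈ D) :
    HasStrictFDerivAt (fun p : ℝ × ℝ => flow H p.1 p.2)
      ((1 / ((1 - η * H α) * G H 0 1 η)) • ContinuousLinearMap.fst ℝ ℝ ℝ +
        (vel H α η) • ContinuousLinearMap.snd ℝ ℝ ℝ) (α, η) := by
  have hK := (P.G_one_pos hη).ne'
  have hJ := (P.pos η hη α).ne'
  have h0 := G_hasStrictFDerivAt P.continuous P.isOpen P.pos 0 α hη
  have h1 : HasStrictFDerivAt (fun p : ℝ × ℝ => G H 0 1 p.2)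
      ((G H 1 1 η) • ContinuousLinearMap.snd ℝ ℝ ℝ) (α, η) := by
    have := (G_hasStrictFDerivAt P.continuous P.isOpen P.pos 0 1 hη).comp (α, η)
      (f := fun p : ℝ × ℝ => ((1, p.2) : ℝ × ℝ))
      ((hasStrictFDerivAt_const (1 : ℝ) _).prodMk hasStrictFDerivAt_snd)
    refine HasStrictFDerivAt.congr_fderiv this ?_
    ext <;> simp
  have h2 := (hasStrictDerivAt_inv hK).comp_hasStrictFDerivAt (α, η) h1
  have h3 := h0.mul h2
  have h4 : (fun p : ℝ × ℝ => flow H p.1 p.2) =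
      fun p : ℝ × ℝ => G H 0 p.1 p.2 * (Inv.inv ∘ fun p : ℝ × ℝ => G H 0 1 p.2) p := by
    ext p; simp [flow, div_eq_mul_inv]
  rw [h4]
  refine HasStrictFDerivAt.congr_fderiv h3 ?_
  ext
  · simp
  · simp [vel]
    field_simp
    ring

lemma hasDerivAt_flow_left (α : ℝ) {η : ℝ} (hη : η ∈ D) :
    HasDerivAt (fun a => flow H a η) (1 / ((1 - η * H α) * G H 0 1 η)) α :=
  (hasDerivAt_fst_of_hasFDerivAt (P.hasStrictFDerivAt_flow α hη).hasFDerivAt).congr_deriv (by simp)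

lemma hasDerivAt_flow_right (α : ℝ) {η : ℝ} (hη : η ∈ D) :
    HasDerivAt (fun x => flow H α x) (vel H α η) η :=
  (hasDerivAt_snd_of_hasFDerivAt (P.hasStrictFDerivAt_flow α hη).hasFDerivAt).congr_deriv (by simp)

lemma flow_deriv_pos (α : ℝ) {η : ℝ} (hη : η ∈ D) : 0 < 1 / ((1 - η * H α) * G H 0 1 η) :=
  one_div_pos.2 (mul_pos (P.pos η hη α) (P.G_one_pos hη))

/-- Positivity of `1 - η H` on the whole line makes the map injective on `ℝ`, not only on `[0,1]`.
Hence `back` is a left inverse everywhere, and the inverse function theorem applies at the endpoints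
too. -/
lemma strictMono_flow {η : ℝ} (hη : η ∈ D) : StrictMono fun α => flow H α η :=
  strictMono_of_hasDerivAt_pos (fun α => P.hasDerivAt_flow_left α hη)
    fun α => P.flow_deriv_pos α hη

lemma back_flow (α : ℝ) {η : ℝ} (hη : η ∈ D) : back H (flow H α η) η = α :=
  Function.leftInverse_invFun (P.strictMono_flow hη).injective α

omit P in
@[simp] lemma flow_zero (η : ℝ) : flow H 0 η = 0 := by simp [flow]

lemma flow_one {η : ℝ} (hη : η ∈ D) : flow H 1 η = 1 := div_self (P.G_one_pos hη).ne'

lemma flow_mem {α : ℝ} (hα : α ∈ Icc (0 : ℝ) 1) {η : ℝ} (hη : η ∈ D) :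
    flow H α η ∈ Icc (0 : ℝ) 1 := by
  have hm := (P.strictMono_flow hη).monotone
  have h0 := hm hα.1
  have h1 := hm hα.2
  simp only [flow_zero, P.flow_one hη] at h0 h1
  exact ⟨h0, h1⟩

lemma exists_flow_eq {x : ℝ} (hx : x ∈ Icc (0 : ℝ) 1) {η : ℝ} (hη : η ∈ D) :
    ∃ α ∈ Icc (0 : ℝ) 1, flow H α η = x := by
  have hc : ContinuousOn (fun a => flow H a η) (Icc 0 1) := fun a _ =>
    (P.hasDerivAt_flow_left a hη).continuousAt.continuousWithinAt
  have := intermediate_value_Icc zero_le_one hc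
  simp only [flow_zero, P.flow_one hη] at this
  exact this hx

lemma back_mem {x : ℝ} (hx : x ∈ Icc (0 : ℝ) 1) {η : ℝ} (hη : η ∈ D) :
    back H x η ∈ Icc (0 : ℝ) 1 := by
  obtain ⟨α, hα, rfl⟩ := P.exists_flow_eq hx hη
  rwa [P.back_flow α hη]

/-- The inverse function theorem is applied to `(α, η) ↦ (flow H α η, η)`, whose triangular
derivative is inverted by hand. -/
lemma hasStrictFDerivAt_back (α : ℝ) {η : ℝ} (hη : η ∈ D) :
    HasStrictFDerivAt (fun p : ℝ × ℝ => back H p.1 p.2)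
      (((1 - η * H α) * G H 0 1 η) • ContinuousLinearMap.fst ℝ ℝ ℝ -
        ((1 - η * H α) * G H 0 1 η * vel H α η) • ContinuousLinearMap.snd ℝ ℝ ℝ)
      (flow H α η, η) := by
  set q := (1 - η * H α) * G H 0 1 η with hq
  have hq0 : q ≠ 0 := (mul_pos (P.pos η hη α) (P.G_one_pos hη)).ne'
  have hinv : ∀ᶠ p : ℝ × ℝ in 𝓝 (α, η),
      (fun p : ℝ × ℝ => (back H p.1 p.2, p.2)) ((fun p : ℝ × ℝ => (flow H p.1 p.2, p.2)) p) = p := by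
    filter_upwards [(isOpen_univ.prod P.isOpen).mem_nhds (⟨trivial, hη⟩ : (α, η) ∈ univ ×ˢ D)]
      with p hp
    exact Prod.ext (P.back_flow p.1 hp.2) rfl
  let e : (ℝ × ℝ) ≃L[ℝ] (ℝ × ℝ) := ContinuousLinearEquiv.equivOfInverse
    (((1 / q) • ContinuousLinearMap.fst ℝ ℝ ℝ + (vel H α η) • ContinuousLinearMap.snd ℝ ℝ ℝ).prod
      (ContinuousLinearMap.snd ℝ ℝ ℝ))
    ((q • ContinuousLinearMap.fst ℝ ℝ ℝ - (q * vel H α η) • ContinuousLinearMap.snd ℝ ℝ ℝ).prod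
      (ContinuousLinearMap.snd ℝ ℝ ℝ))
    (fun p => by
      ext
      · simp
        field_simp
        ring
      · simp)
    (fun p => by
      ext
      · simp
        field_simp
        ring
      · simp)
  have h := HasStrictFDerivAt.to_local_left_inverse (f' := e) (a := ((α, η) : ℝ × ℝ))
    (f := fun p : ℝ × ℝ => (flow H p.1 p.2, p.2))
    (g := fun p : ℝ × ℝ => (back H p.1 p.2, p.2))
    ((P.hasStrictFDerivAt_flow α hη).prodMk hasStrictFDerivAt_snd) hinv
  have h2 := (hasStrictFDerivAt_fst (𝕜 := ℝ) (E := ℝ) (F := ℝ)).comp _ h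
  refine HasStrictFDerivAt.congr_fderiv h2 ?_
  have hsymm : (e.symm : ℝ × ℝ →L[ℝ] ℝ × ℝ) =
      (q • ContinuousLinearMap.fst ℝ ℝ ℝ - (q * vel H α η) • ContinuousLinearMap.snd ℝ ℝ ℝ).prod
        (ContinuousLinearMap.snd ℝ ℝ ℝ) := rfl
  rw [hsymm]
  ext <;> simp

lemma contDiffOn_H : ContDiffOn ℝ ∞ (fun p : ℝ × ℝ => H p.1) (Icc 0 1 ×ˢ D) :=
  P.smooth.comp contDiffOn_fst fun _ hp => hp.1

lemma contDiffOn_G (k : ℕ) : ContDiffOn ℝ ∞ (fun p : ℝ × ℝ => G H k p.1 p.2) (Icc 0 1 ×ˢ D) :=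
  G_contDiffOn P.continuous P.smooth P.isOpen P.pos k

lemma contDiffOn_G_one (k : ℕ) : ContDiffOn ℝ ∞ (fun η => G H k 1 η) D :=
  (P.contDiffOn_G k).comp (f := fun η : ℝ => ((1, η) : ℝ × ℝ))
    (contDiffOn_const.prodMk contDiffOn_id) fun η hη => ⟨by simp, hη⟩

lemma contDiffOn_G_one' (k : ℕ) :
    ContDiffOn ℝ ∞ (fun p : ℝ × ℝ => G H k 1 p.2) (Icc 0 1 ×ˢ D) :=
  (P.contDiffOn_G_one k).comp contDiffOn_snd fun _ hp => hp.2

lemma contDiffOn_vel : ContDiffOn ℝ ∞ (fun p : ℝ × ℝ => vel H p.1 p.2) (Icc 0 1 ×ˢ D) :=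
  (((P.contDiffOn_G 1).div (P.contDiffOn_G_one' 0) fun _ hp => (P.G_one_pos hp.2).ne').sub
    (((P.contDiffOn_G 0).mul (P.contDiffOn_G_one' 1)).div ((P.contDiffOn_G_one' 0).pow 2)
      fun _ hp => (pow_pos (P.G_one_pos hp.2) 2).ne'))

/-- Bootstrap: the derivative of `back` is a smooth expression in `back` itself, so each order of
smoothness yields the next. -/
lemma contDiffOn_back : ContDiffOn ℝ ∞ (fun p : ℝ × ℝ => back H p.1 p.2) (Icc 0 1 ×ˢ D) := by
  have hder : ∀ p ∈ Icc (0 : ℝ) 1 ×ˢ D, HasFDerivAt (fun p : ℝ × ℝ => back H p.1 p.2)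
      (((1 - p.2 * H (back H p.1 p.2)) * G H 0 1 p.2) • ContinuousLinearMap.fst ℝ ℝ ℝ -
        ((1 - p.2 * H (back H p.1 p.2)) * G H 0 1 p.2 * vel H (back H p.1 p.2) p.2) •
          ContinuousLinearMap.snd ℝ ℝ ℝ) p := by
    rintro ⟨x, η⟩ ⟨hx, hη⟩
    change x ∈ Icc (0 : ℝ) 1 at hx
    change η ∈ D at hη
    obtain ⟨α, hα, rfl⟩ := P.exists_flow_eq hx hη
    simp only [P.back_flow α hη]
    exact (P.hasStrictFDerivAt_back α hη).hasFDerivAt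
  rw [contDiffOn_infty]
  intro n
  induction n with
  | zero =>
    exact contDiffOn_zero.2 fun p hp => (hder p hp).continuousAt.continuousWithinAt
  | succ n ih =>
    push_cast
    rw [contDiffOn_succ_iff_hasFDerivWithinAt_of_uniqueDiffOn
      (uniqueDiffOn_strip P.isOpen.uniqueDiffOn)]
    refine ⟨by simp, _, ?_, fun p hp => (hder p hp).hasFDerivWithinAt⟩
    have hn : ((n : ℕ∞) : WithTop ℕ∞) ≤ (∞ : ℕ∞ω) := by exact_mod_cast le_top
    have hmap : MapsTo (fun p : ℝ × ℝ => (back H p.1 p.2, p.2)) (Icc 0 1 ×ˢ D) (Icc 0 1 ×ˢ D) :=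
      fun _ hp => ⟨P.back_mem hp.1 hp.2, hp.2⟩
    have hpair := ih.prodMk (contDiffOn_snd (n := n) (𝕜 := ℝ) (E := ℝ) (F := ℝ)
      (s := Icc (0 : ℝ) 1 ×ˢ D))
    have h1 := (P.contDiffOn_H.of_le hn).comp hpair hmap
    have h2 := (P.contDiffOn_vel.of_le hn).comp hpair hmap
    have h3 := (contDiffOn_const (c := (1 : ℝ)).sub (contDiffOn_snd.mul h1)).mul
      ((P.contDiffOn_G_one' 0).of_le hn)
    exact (h3.smul contDiffOn_const).sub ((h3.mul h2).smul contDiffOn_const)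

/-- The velocity field in rescaled time, in Eulerian coordinates, is smooth. -/
lemma contDiffOn_vel_back :
    ContDiffOn ℝ ∞ (fun p : ℝ × ℝ => vel H (back H p.1 p.2) p.2) (Icc 0 1 ×ˢ D) :=
  P.contDiffOn_vel.comp (P.contDiffOn_back.prodMk contDiffOn_snd)
    fun _ hp => ⟨P.back_mem hp.1 hp.2, hp.2⟩

lemma hasDerivAt_vel_left (α : ℝ) {η : ℝ} (hη : η ∈ D) :
    HasDerivAt (fun a => vel H a η) (H α / (1 - η * H α) ^ 2 / G H 0 1 η -
      1 / (1 - η * H α) * G H 1 1 η / G H 0 1 η ^ 2) α := by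
  have h0 := G_hasDerivAt_left P.continuous P.isOpen P.pos 0 α hη
  have h1 := G_hasDerivAt_left P.continuous P.isOpen P.pos 1 α hη
  exact ((h1.div_const _).sub ((h0.mul_const _).div_const _)).congr_deriv (by simp)

/-- The inverse Jacobian `(1 - η H α) K_0` cancels one power of `1 - η H α`, leaving a function of
`H α` and `η` only. -/
lemma hasDerivAt_vel_back (α : ℝ) {η : ℝ} (hη : η ∈ D) :
    HasDerivAt (fun x => vel H (back H x η) η) (H α / (1 - η * H α) - G H 1 1 η / G H 0 1 η)
      (flow H α η) := by
  have hK := (P.G_one_pos hη).ne'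
  have hJ := (P.pos η hη α).ne'
  have h1 : HasDerivAt (fun x => back H x η) ((1 - η * H α) * G H 0 1 η) (flow H α η) :=
    (hasDerivAt_fst_of_hasFDerivAt (P.hasStrictFDerivAt_back α hη).hasFDerivAt).congr_deriv
      (by simp)
  have h2 := P.hasDerivAt_vel_left (back H (flow H α η) η) hη
  refine (HasDerivAt.comp (flow H α η) (h₂ := fun a => vel H a η)
    (h := fun x => back H x η) h2 h1).congr_deriv ?_
  rw [P.back_flow α hη]
  generalize 1 - η * H α = J at hJ ⊢
  field_simp

omit P in
@[simp] lemma vel_zero (η : ℝ) : vel H 0 η = 0 := by simp [vel]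

lemma vel_one {η : ℝ} (hη : η ∈ D) : vel H 1 η = 0 := by
  have hK := (P.G_one_pos hη).ne'
  rw [vel]
  field_simp
  ring

end IsProfile

end NonlocalBlowup

namespace NonlocalBlowup

/-! ### Calculus on the strip `[0,1] × I` -/

section Strip

variable {f : ℝ → ℝ → ℝ} {I : Set ℝ}

lemma hasDerivWithinAt_fst {L : ℝ × ℝ →L[ℝ] ℝ} {X : Set ℝ} {x t : ℝ} (ht : t ∈ I)
    (h : HasFDerivWithinAt (fun p : ℝ × ℝ => f p.1 p.2) L (X ×ˢ I) (x, t)) :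
    HasDerivWithinAt (fun y => f y t) (L (1, 0)) X x :=
  h.comp_hasDerivWithinAt x (f := fun s : ℝ => ((s, t) : ℝ × ℝ))
    ((hasDerivWithinAt_id x X).prodMk (hasDerivWithinAt_const x X t)) fun _ hs => ⟨hs, ht⟩

lemma hasDerivWithinAt_snd {L : ℝ × ℝ →L[ℝ] ℝ} {X : Set ℝ} {x t : ℝ} (hx : x ∈ X)
    (h : HasFDerivWithinAt (fun p : ℝ × ℝ => f p.1 p.2) L (X ×ˢ I) (x, t)) :
    HasDerivWithinAt (fun s => f x s) (L (0, 1)) I t :=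
  h.comp_hasDerivWithinAt t (f := fun s : ℝ => ((x, s) : ℝ × ℝ))
    ((hasDerivWithinAt_const t I x).prodMk (hasDerivWithinAt_id t I)) fun _ hs => ⟨hx, hs⟩

variable (hf : ContDiffOn ℝ ∞ (fun p : ℝ × ℝ => f p.1 p.2) (Icc 0 1 ×ˢ I))

include hf

lemma hasFDerivWithinAt_strip {x t : ℝ} (hx : x ∈ Icc (0 : ℝ) 1) (ht : t ∈ I) :
    HasFDerivWithinAt (fun p : ℝ × ℝ => f p.1 p.2)
      (fderivWithin ℝ (fun p : ℝ × ℝ => f p.1 p.2) (Icc 0 1 ×ˢ I) (x, t))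
      (Icc 0 1 ×ˢ I) (x, t) :=
  (hf.differentiableOn (by simp) (x, t) ⟨hx, ht⟩).hasFDerivWithinAt

lemma ux_eq_fderivWithin {x t : ℝ} (hx : x ∈ Icc (0 : ℝ) 1) (ht : t ∈ I) :
    ux f x t = fderivWithin ℝ (fun p : ℝ × ℝ => f p.1 p.2) (Icc 0 1 ×ˢ I) (x, t) (1, 0) :=
  (hasDerivWithinAt_fst ht (hasFDerivWithinAt_strip hf hx ht)).derivWithin
    (uniqueDiffOn_Icc one_pos x hx)

lemma hasDerivWithinAt_ux {x t : ℝ} (hx : x ∈ Icc (0 : ℝ) 1) (ht : t ∈ I) :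
    HasDerivWithinAt (fun y => f y t) (ux f x t) (Icc 0 1) x := by
  rw [ux_eq_fderivWithin hf hx ht]
  exact hasDerivWithinAt_fst ht (hasFDerivWithinAt_strip hf hx ht)

lemma contDiffOn_ux (hI : UniqueDiffOn ℝ I) :
    ContDiffOn ℝ ∞ (fun p : ℝ × ℝ => ux f p.1 p.2) (Icc 0 1 ×ˢ I) := by
  have h := hf.fderivWithin (m := ∞) (uniqueDiffOn_strip hI) (by simp)
  exact (h.clm_apply contDiffOn_const).congr fun p hp => ux_eq_fderivWithin hf hp.1 hp.2

lemma continuousOn_slice {t : ℝ} (ht : t ∈ I) : ContinuousOn (fun y => f y t) (Icc 0 1) :=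
  hf.continuousOn.comp (f := fun s : ℝ => ((s, t) : ℝ × ℝ)) (by fun_prop) fun _ hs => ⟨hs, ht⟩

lemma hasDerivAt_time (hI : IsOpen I) {x t : ℝ} (hx : x ∈ Icc (0 : ℝ) 1) (ht : t ∈ I) :
    HasDerivAt (fun s => f x s)
      (fderivWithin ℝ (fun p : ℝ × ℝ => f p.1 p.2) (Icc 0 1 ×ˢ I) (x, t) (0, 1)) t :=
  (hasDerivWithinAt_snd hx (hasFDerivWithinAt_strip hf hx ht)).hasDerivAt (hI.mem_nhds ht)

lemma contDiffOn_deriv_time (hI : IsOpen I) :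
    ContDiffOn ℝ ∞ (fun p : ℝ × ℝ => deriv (fun s => f p.1 s) p.2) (Icc 0 1 ×ˢ I) := by
  have h := hf.fderivWithin (m := ∞) (uniqueDiffOn_strip hI.uniqueDiffOn) (by simp)
  exact (h.clm_apply contDiffOn_const).congr fun p hp =>
    (hasDerivAt_time hf hI hp.1 hp.2).deriv

lemma hasDerivAt_deriv_time (hI : IsOpen I) {x t : ℝ} (hx : x ∈ Icc (0 : ℝ) 1) (ht : t ∈ I) :
    HasDerivAt (fun s => f x s) (deriv (fun s => f x s) t) t :=
  (hasDerivAt_time hf hI hx ht).differentiableAt.hasDerivAt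

lemma hasDerivAt_integral_strip (hI : IsOpen I) {t : ℝ} (ht : t ∈ I) :
    HasDerivAt (fun s => ∫ y in (0 : ℝ)..1, f y s)
      (∫ y in (0 : ℝ)..1, deriv (fun s => f y s) t) t := by
  refine hasDerivAt_intervalIntegral_param (f' := fun y s => deriv (fun s => f y s) s) hI
    ?_ ?_ ?_ ht
  · rw [uIcc_of_le zero_le_one]; exact hf.continuousOn
  · rw [uIcc_of_le zero_le_one]; exact (contDiffOn_deriv_time hf hI).continuousOn
  · rw [uIcc_of_le zero_le_one]
    exact fun s hs η hη => hasDerivAt_deriv_time hf hI hs hη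

end Strip

/-- The fundamental theorem of calculus for one-sided derivatives on `[0,1]`. -/
lemma integral_eq_sub_of_hasDerivWithinAt {f f' : ℝ → ℝ}
    (hf : ∀ x ∈ Icc (0 : ℝ) 1, HasDerivWithinAt f (f' x) (Icc 0 1) x)
    (hf' : ContinuousOn f' (Icc 0 1)) {x : ℝ} (hx : x ∈ Icc (0 : ℝ) 1) :
    ∫ y in (0 : ℝ)..x, f' y = f x - f 0 := by
  have hsub : Icc 0 x ⊆ Icc (0 : ℝ) 1 := Icc_subset_Icc_right hx.2
  refine intervalIntegral.integral_eq_sub_of_hasDerivAt_of_le hx.1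
    (fun y hy => ((hf y (hsub hy)).continuousWithinAt).mono hsub)
    (fun y hy => (hf y (hsub (Ioo_subset_Icc_self hy))).hasDerivAt
      (Icc_mem_nhds hy.1 (hy.2.trans_le hx.2))) ?_
  exact ContinuousOn.intervalIntegrable (by rw [uIcc_of_le hx.1]; exact hf'.mono hsub)

/-- Expanding `∫₀ˣ (f - c)² ≥ 0` gives `∫₀ˣ f² ≥ 2c² - c²x`, which is at least `c²` because `x ≤ 1`.
-/
lemma sq_integral_le_integral_sq {f : ℝ → ℝ} (hf : ContinuousOn f (Icc 0 1)) {x : ℝ}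
    (hx : x ∈ Icc (0 : ℝ) 1) :
    (∫ y in (0 : ℝ)..x, f y) ^ 2 ≤ ∫ y in (0 : ℝ)..1, f y ^ 2 := by
  set c := ∫ y in (0 : ℝ)..x, f y with hc
  have hfx : ContinuousOn f (uIcc 0 x) := by
    rw [uIcc_of_le hx.1]; exact hf.mono (Icc_subset_Icc_right hx.2)
  have hx1 : ContinuousOn f (uIcc x 1) := by
    rw [uIcc_of_le hx.2]; exact hf.mono (Icc_subset_Icc_left hx.1)
  have h1 : 0 ≤ ∫ y in (0 : ℝ)..x, (f y - c) ^ 2 :=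
    intervalIntegral.integral_nonneg hx.1 fun y _ => sq_nonneg _
  have h2 : ∫ y in (0 : ℝ)..x, (f y - c) ^ 2 =
      (∫ y in (0 : ℝ)..x, f y ^ 2) - 2 * c * c + c ^ 2 * x := by
    have e : ∀ y, (f y - c) ^ 2 = f y ^ 2 - 2 * c * f y + c ^ 2 := fun y => by ring
    simp_rw [e]
    rw [intervalIntegral.integral_add, intervalIntegral.integral_sub,
      intervalIntegral.integral_const_mul, ← hc, intervalIntegral.integral_const, sub_zero,
      smul_eq_mul, mul_comm x]
    all_goals exact ContinuousOn.intervalIntegrable (by fun_prop)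
  have h3 : (∫ y in (0 : ℝ)..x, f y ^ 2) + ∫ y in x..1, f y ^ 2 = ∫ y in (0 : ℝ)..1, f y ^ 2 :=
    intervalIntegral.integral_add_adjacent_intervals
      (ContinuousOn.intervalIntegrable (by fun_prop))
      (ContinuousOn.intervalIntegrable (by fun_prop))
  have h4 : 0 ≤ ∫ y in x..1, f y ^ 2 :=
    intervalIntegral.integral_nonneg hx.2 fun y _ => sq_nonneg _
  nlinarith [mul_le_mul_of_nonneg_left hx.2 (sq_nonneg c)]

/-- Grönwall's inequality for a nonnegative function which vanishes initially. -/
lemma eq_zero_of_hasDerivAt_le {E E' : ℝ → ℝ} {C b : ℝ} (hb : 0 ≤ b)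
    (hE : ContinuousOn E (Icc 0 b)) (hd : ∀ t ∈ Ioo 0 b, HasDerivAt E (E' t) t)
    (hle : ∀ t ∈ Ioo 0 b, E' t ≤ C * E t) (h0 : E 0 = 0) (hpos : 0 ≤ E b) : E b = 0 := by
  have hder : ∀ t ∈ Ioo 0 b, HasDerivAt (fun t => E t * Real.exp (-C * t))
      ((E' t - C * E t) * Real.exp (-C * t)) t := fun t ht => by
    have he : HasDerivAt (fun t => Real.exp (-C * t)) (Real.exp (-C * t) * -C) t := by
      simpa using ((hasDerivAt_id t).const_mul (-C)).exp
    exact ((hd t ht).mul he).congr_deriv (by ring)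
  -- The integrating factor `exp (-C t)` turns the differential inequality into monotonicity.
  have hanti : AntitoneOn (fun t => E t * Real.exp (-C * t)) (Icc 0 b) := by
    refine antitoneOn_of_deriv_nonpos (convex_Icc 0 b) (hE.mul (by fun_prop)) ?_ ?_
    · rw [interior_Icc]
      exact fun t ht => (hder t ht).differentiableAt.differentiableWithinAt
    · rw [interior_Icc]
      intro t ht
      rw [(hder t ht).deriv]
      exact mul_nonpos_of_nonpos_of_nonneg (by linarith [hle t ht]) (Real.exp_pos _).le
  have := hanti (left_mem_Icc.2 hb) (right_mem_Icc.2 hb) hb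
  simp only [h0, zero_mul] at this
  nlinarith [Real.exp_pos (-C * b)]

/-! ### Uniqueness by an energy estimate -/

namespace IsSmoothSolution

variable {u₀ : ℝ → ℝ} {T : ℝ} {u v : ℝ → ℝ → ℝ}

lemma mono {T' : ℝ} (hT : T' ≤ T) (hu : IsSmoothSolution u₀ T u) : IsSmoothSolution u₀ T' u where
  smooth := hu.smooth.mono (prod_mono le_rfl (Ico_subset_Ico_right hT))
  equation x hx t ht := hu.equation x hx t ⟨ht.1, ht.2.trans_le hT⟩
  initial := hu.initial
  boundary t ht := hu.boundary t ⟨ht.1, ht.2.trans_le hT⟩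

/-- The energy identity for the difference of two solutions. -/
lemma hasDerivAt_energy (hu : IsSmoothSolution u₀ T u) (hv : IsSmoothSolution u₀ T v) {t : ℝ}
    (ht : t ∈ Ioo 0 T) :
    HasDerivAt (fun s => ∫ y in (0 : ℝ)..1, (ux v y s - ux u y s) ^ 2)
      (∫ y in (0 : ℝ)..1, (ux u y t * (ux v y t - ux u y t) ^ 2
        - 2 * (v y t - u y t) * uxx v y t * (ux v y t - ux u y t)
        + 2 * (ux v y t - ux u y t) ^ 2 * (ux v y t + ux u y t))) t := by
  have hU := uniqueDiffOn_Ico 0 T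
  have htI := Ioo_subset_Ico_self ht
  have hsub : Icc (0 : ℝ) 1 ×ˢ Ioo 0 T ⊆ Icc 0 1 ×ˢ Ico 0 T := prod_mono le_rfl Ioo_subset_Ico_self
  have cu := contDiffOn_ux hu.smooth hU
  have cv := contDiffOn_ux hv.smooth hU
  have cuu := contDiffOn_ux cu hU
  have cvv := contDiffOn_ux cv hU
  have su := continuousOn_slice hu.smooth htI
  have sv := continuousOn_slice hv.smooth htI
  have sux := continuousOn_slice cu htI
  have svx := continuousOn_slice cv htI
  have suxx : ContinuousOn (fun y => uxx u y t) (Icc 0 1) := continuousOn_slice cuu htI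
  have svxx : ContinuousOn (fun y => uxx v y t) (Icc 0 1) := continuousOn_slice cvv htI
  have ii : ∀ {g : ℝ → ℝ}, ContinuousOn g (Icc 0 1) → IntervalIntegrable g volume 0 1 :=
    fun hg => ContinuousOn.intervalIntegrable (by rwa [uIcc_of_le zero_le_one])
  have h1 := hasDerivAt_integral_strip (f := fun y s => (ux v y s - ux u y s) ^ 2)
    (((cv.sub cu).pow 2).mono hsub) isOpen_Ioo ht
  refine h1.congr_deriv ?_
  set Δ := 2 * (∫ y in (0 : ℝ)..1, ux v y t ^ 2) - 2 * ∫ y in (0 : ℝ)..1, ux u y t ^ 2 with hΔ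
  -- With `w = v_x - u_x`, the integrand splits into the claimed one, the exact derivative `(u
  -- w²)_x`, and a multiple of `w` that is constant in `y` and comes from the nonlocal terms.
  have hint : ∀ y ∈ Icc (0 : ℝ) 1, deriv (fun s => (ux v y s - ux u y s) ^ 2) t =
      (ux u y t * (ux v y t - ux u y t) ^ 2
        - 2 * (v y t - u y t) * uxx v y t * (ux v y t - ux u y t)
        + 2 * (ux v y t - ux u y t) ^ 2 * (ux v y t + ux u y t))
      - (ux u y t * (ux v y t - ux u y t) ^ 2
        + u y t * (2 * (ux v y t - ux u y t) * (uxx v y t - uxx u y t)))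
      - 2 * Δ * (ux v y t - ux u y t) := fun y hy => by
    have du := hasDerivAt_deriv_time (cu.mono hsub) isOpen_Ioo hy ht
    have dv := hasDerivAt_deriv_time (cv.mono hsub) isOpen_Ioo hy ht
    have hd := HasDerivAt.deriv (f := fun s => (ux v y s - ux u y s) ^ 2) ((dv.sub du).pow 2)
    rw [hd]
    have eu := hu.equation y hy t ht
    have ev := hv.equation y hy t ht
    rw [uxt] at eu ev
    have hdiff : deriv (fun s => ux v y s) t - deriv (fun s => ux u y s) t =
        -(v y t * uxx v y t) + ux v y t ^ 2 + u y t * uxx u y t - ux u y t ^ 2 - Δ := by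
      rw [hΔ]; linear_combination ev - eu
    simp only [Pi.sub_apply, Nat.cast_ofNat, Nat.add_one_sub_one, pow_one]
    rw [hdiff]
    ring
  -- The boundary condition on `u` kills the exact derivative.
  have hQ : ∫ y in (0 : ℝ)..1, (ux u y t * (ux v y t - ux u y t) ^ 2
      + u y t * (2 * (ux v y t - ux u y t) * (uxx v y t - uxx u y t))) = 0 := by
    rw [integral_eq_sub_of_hasDerivWithinAt (f := fun y => u y t * (ux v y t - ux u y t) ^ 2)
      (fun y hy => ?_) (by fun_prop) (right_mem_Icc.2 zero_le_one)]
    · simp [(hu.boundary t htI).1, (hu.boundary t htI).2]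
    · have d1 := hasDerivWithinAt_ux hu.smooth hy htI
      have d2 : HasDerivWithinAt (fun y => ux u y t) (uxx u y t) (Icc 0 1) y :=
        hasDerivWithinAt_ux cu hy htI
      have d3 : HasDerivWithinAt (fun y => ux v y t) (uxx v y t) (Icc 0 1) y :=
        hasDerivWithinAt_ux cv hy htI
      exact (d1.mul ((d3.sub d2).pow 2)).congr_deriv (by simp)
  -- The boundary conditions give `w` mean zero, so the difference of the nonlocal terms drops out.
  have hD : ∫ y in (0 : ℝ)..1, (ux v y t - ux u y t) = 0 := by
    rw [integral_eq_sub_of_hasDerivWithinAt (f := fun y => v y t - u y t)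
      (fun y hy => (hasDerivWithinAt_ux hv.smooth hy htI).sub
        (hasDerivWithinAt_ux hu.smooth hy htI)) (by fun_prop) (right_mem_Icc.2 zero_le_one)]
    simp [(hu.boundary t htI).1, (hu.boundary t htI).2, (hv.boundary t htI).1,
      (hv.boundary t htI).2]
  rw [intervalIntegral.integral_congr (fun y hy => hint y (by rwa [uIcc_of_le zero_le_one] at hy)),
    intervalIntegral.integral_sub, intervalIntegral.integral_sub, hQ,
    intervalIntegral.integral_const_mul, hD]
  · ring
  all_goals exact ii (by fun_prop)

/-- Smooth solutions are unique. -/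
theorem eqOn (hu : IsSmoothSolution u₀ T u) (hv : IsSmoothSolution u₀ T v) {x t : ℝ}
    (hx : x ∈ Icc (0 : ℝ) 1) (ht : t ∈ Ico 0 T) : v x t = u x t := by
  have hU := uniqueDiffOn_Ico 0 T
  have cu := contDiffOn_ux hu.smooth hU
  have cv := contDiffOn_ux hv.smooth hU
  have cvv := contDiffOn_ux cv hU
  have hsubI : Icc 0 t ⊆ Ico 0 T := fun s hs => ⟨hs.1, hs.2.trans_lt ht.2⟩
  have hsub : Icc (0 : ℝ) 1 ×ˢ Icc 0 t ⊆ Icc 0 1 ×ˢ Ico 0 T := prod_mono le_rfl hsubI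
  have hK : IsCompact (Icc (0 : ℝ) 1 ×ˢ Icc 0 t) := isCompact_Icc.prod isCompact_Icc
  obtain ⟨C₁, hC₁⟩ := hK.exists_bound_of_continuousOn (cu.continuousOn.mono hsub)
  obtain ⟨C₂, hC₂⟩ := hK.exists_bound_of_continuousOn (cv.continuousOn.mono hsub)
  obtain ⟨C₃, hC₃⟩ := hK.exists_bound_of_continuousOn (cvv.continuousOn.mono hsub)
  have ii : ∀ {g : ℝ → ℝ}, ContinuousOn g (Icc 0 1) → IntervalIntegrable g volume 0 1 :=
    fun hg => ContinuousOn.intervalIntegrable (by rwa [uIcc_of_le zero_le_one])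
  set E : ℝ → ℝ := fun s => ∫ y in (0 : ℝ)..1, (ux v y s - ux u y s) ^ 2 with hE
  -- This one-dimensional Sobolev bound controls the undifferentiated factor `v - u`, which
  -- multiplies `v_xx` in the energy identity.
  have sob : ∀ s ∈ Ico 0 T, ∀ y ∈ Icc (0 : ℝ) 1, (v y s - u y s) ^ 2 ≤ E s := by
    intro s hs y hy
    have sux := continuousOn_slice cu hs
    have svx := continuousOn_slice cv hs
    have h := sq_integral_le_integral_sq (f := fun y => ux v y s - ux u y s) (by fun_prop) hy
    rw [integral_eq_sub_of_hasDerivWithinAt (f := fun y => v y s - u y s)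
      (fun y hy => (hasDerivWithinAt_ux hv.smooth hy hs).sub
        (hasDerivWithinAt_ux hu.smooth hy hs)) (by fun_prop) hy] at h
    simpa [(hu.boundary s hs).1, (hv.boundary s hs).1] using h
  have hE0 : E t = 0 := by
    -- The terms in `w²` contribute `C₁ + 2 (C₁ + C₂)`. Young's inequality and `sob` bound the
    -- `v_xx` term by `C₃ (E + w²)`, which integrates to `2 C₃ E`.
    refine eq_zero_of_hasDerivAt_le (C := 3 * C₁ + 2 * C₂ + 2 * C₃) ht.1 ?_
      (fun s hs => hasDerivAt_energy hu hv ⟨hs.1, hs.2.trans ht.2⟩) ?_ ?_ ?_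
    · exact continuousOn_intervalIntegral_param zero_le_one
        (((cv.sub cu).pow 2).continuousOn.mono hsub)
    · intro s hs
      have hsI : s ∈ Ico 0 T := hsubI (Ioo_subset_Icc_self hs)
      have su := continuousOn_slice hu.smooth hsI
      have sv := continuousOn_slice hv.smooth hsI
      have sux := continuousOn_slice cu hsI
      have svx := continuousOn_slice cv hsI
      have svxx : ContinuousOn (fun y => uxx v y s) (Icc 0 1) := continuousOn_slice cvv hsI
      have hle : ∫ y in (0 : ℝ)..1, (ux u y s * (ux v y s - ux u y s) ^ 2
          - 2 * (v y s - u y s) * uxx v y s * (ux v y s - ux u y s)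
          + 2 * (ux v y s - ux u y s) ^ 2 * (ux v y s + ux u y s)) ≤
          ∫ y in (0 : ℝ)..1, ((3 * C₁ + 2 * C₂ + C₃) * (ux v y s - ux u y s) ^ 2
            + C₃ * E s) := by
        refine intervalIntegral.integral_mono_on zero_le_one (ii (by fun_prop)) (ii (by fun_prop))
          fun y hy => ?_
        have b1 := abs_le.1 (hC₁ (y, s) ⟨hy, Ioo_subset_Icc_self hs⟩)
        have b2 := abs_le.1 (hC₂ (y, s) ⟨hy, Ioo_subset_Icc_self hs⟩)
        have b3 : |uxx v y s| ≤ C₃ := hC₃ (y, s) ⟨hy, Ioo_subset_Icc_self hs⟩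
        have b4 := sob s hsI y hy
        simp only at b1 b2
        generalize ux u y s = p at *
        generalize ux v y s = r at *
        generalize v y s - u y s = w at *
        generalize uxx v y s = q at *
        have hq : -(2 * w * q * (r - p)) ≤ C₃ * (E s + (r - p) ^ 2) := by
          have a1 : -(2 * w * q * (r - p)) ≤ |q| * (2 * |w * (r - p)|) := by
            rw [show -(2 * w * q * (r - p)) = -(q * (2 * (w * (r - p)))) by ring]
            refine (neg_le_abs _).trans (le_of_eq ?_)
            rw [abs_mul, abs_mul 2, abs_two]
          have a2 : 2 * |w * (r - p)| ≤ E s + (r - p) ^ 2 := by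
            rw [abs_mul]
            nlinarith [sq_nonneg (|w| - |r - p|), sq_abs w, sq_abs (r - p)]
          calc _ ≤ _ := a1
            _ ≤ |q| * (E s + (r - p) ^ 2) := by gcongr
            _ ≤ _ := by
              gcongr
              exact (mul_nonneg zero_le_two (abs_nonneg _)).trans a2
        nlinarith [mul_le_mul_of_nonneg_right b1.2 (sq_nonneg (r - p)),
          mul_le_mul_of_nonneg_right b2.2 (sq_nonneg (r - p))]
      refine hle.trans (le_of_eq ?_)
      rw [intervalIntegral.integral_add, intervalIntegral.integral_const_mul,
        intervalIntegral.integral_const]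
      · simp only [hE, sub_zero, one_smul]; ring
      all_goals exact ii (by fun_prop)
    · have h0 : ∀ y ∈ Icc (0 : ℝ) 1, ux v y 0 = ux u y 0 := fun y hy =>
        derivWithin_congr (fun z hz => (hv.initial z hz).trans (hu.initial z hz).symm)
          ((hv.initial y hy).trans (hu.initial y hy).symm)
      have : E 0 = ∫ y in (0 : ℝ)..1, (0 : ℝ) := intervalIntegral.integral_congr fun y hy => by
        rw [uIcc_of_le zero_le_one] at hy
        simp [h0 y hy]
      simpa using this
    · exact intervalIntegral.integral_nonneg zero_le_one fun y _ => sq_nonneg _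
  have := sob t ht x hx
  rw [hE0] at this
  exact sub_eq_zero.1 (pow_eq_zero_iff two_ne_zero |>.1 (le_antisymm this (sq_nonneg _)))

end IsSmoothSolution

end NonlocalBlowup

namespace NonlocalBlowup

/-! ### The explicit solution -/

/-- `e` is the rescaled time as a function of time on `(t₀, T)`, that is,
`e' = (∫₀¹ (1 - e H)⁻¹)⁻²` and `e(0) = 0`. -/
structure IsClock (H : ℝ → ℝ) (D : Set ℝ) (t₀ T : ℝ) (e : ℝ → ℝ) : Prop where
  neg : t₀ < 0
  mem : ∀ t ∈ Ioo t₀ T, e t ∈ D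
  hasDerivAt : ∀ t ∈ Ioo t₀ T, HasDerivAt e ((G H 0 1 (e t) ^ 2)⁻¹) t
  zero : e 0 = 0

/-- The velocity field `u` of the flow `(α, t) ↦ flow H α (e t)`. -/
noncomputable def sol (H e : ℝ → ℝ) (x t : ℝ) : ℝ :=
  vel H (back H x (e t)) (e t) / G H 0 1 (e t) ^ 2

/-- The function `φ''/φ` for `φ = G H 0 1 ∘ e`, in terms of the rescaled time. -/
noncomputable def forcing (H : ℝ → ℝ) (η : ℝ) : ℝ :=
  (2 * G H 2 1 η / G H 0 1 η ^ 2 - 2 * G H 1 1 η ^ 2 / G H 0 1 η ^ 3) / G H 0 1 η ^ 3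

namespace IsProfile

variable {H : ℝ → ℝ} {D : Set ℝ} (P : IsProfile H D)

include P

lemma hasDerivAt_G_zero {η : ℝ} (hη : η ∈ D) : HasDerivAt (G H 0 1) (G H 1 1 η) η :=
  (P.hasDerivAt_G_one 0 hη).congr_deriv (by simp)

lemma hasDerivAt_G_one_one {η : ℝ} (hη : η ∈ D) : HasDerivAt (G H 1 1) (2 * G H 2 1 η) η :=
  (P.hasDerivAt_G_one 1 hη).congr_deriv (by norm_num)

end IsProfile

lemma G_zero_zero (H : ℝ → ℝ) (α : ℝ) : G H 0 α 0 = α := by simp [G]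

/-- At `η = 0` the integral is that of `u₀'`. This supplies the initial data, and at `α = 1` it
gives `φ'(0) = 0`. -/
lemma G_one_zero {H u₀ : ℝ → ℝ} (hu₀ : ContDiffOn ℝ ∞ u₀ (Icc 0 1)) (h0 : u₀ 0 = 0)
    (hH : ∀ x ∈ Icc (0 : ℝ) 1, H x = dI u₀ x) {α : ℝ} (hα : α ∈ Icc (0 : ℝ) 1) :
    G H 1 α 0 = u₀ α := by
  have hcong : G H 1 α 0 = ∫ s in (0 : ℝ)..α, dI u₀ s := by
    refine intervalIntegral.integral_congr fun s hs => ?_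
    rw [uIcc_of_le hα.1] at hs
    simp [hH s ⟨hs.1, hs.2.trans hα.2⟩]
  rw [hcong, integral_eq_sub_of_hasDerivWithinAt (f := u₀) (f' := dI u₀) (fun y hy =>
    (hu₀.differentiableOn (by simp) y hy).hasDerivWithinAt)
    (hu₀.continuousOn_derivWithin (uniqueDiffOn_Icc one_pos) (by simp)) hα, h0, sub_zero]

namespace IsClock

variable {H : ℝ → ℝ} {D : Set ℝ} {t₀ T : ℝ} {e : ℝ → ℝ} (c : IsClock H D t₀ T e)
  (P : IsProfile H D)

include c

/-- Starting the clock at a negative time puts `t = 0` in the interior: smoothness up to `t = 0` and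
one-sided derivatives there follow by restriction. -/
lemma Ico_subset : Ico 0 T ⊆ Ioo t₀ T := fun _ ht => ⟨c.neg.trans_le ht.1, ht.2⟩

include P

/-- Bootstrap on the equation `e' = K_0(e)⁻²`, whose right side is smooth in `e`. -/
lemma contDiffOn : ContDiffOn ℝ ∞ e (Ioo t₀ T) := by
  rw [contDiffOn_infty]
  intro n
  induction n with
  | zero =>
    exact contDiffOn_zero.2 fun t ht => (c.hasDerivAt t ht).continuousAt.continuousWithinAt
  | succ n ih =>
    push_cast
    rw [contDiffOn_succ_iff_deriv_of_isOpen isOpen_Ioo]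
    refine ⟨fun t ht => (c.hasDerivAt t ht).differentiableAt.differentiableWithinAt, by simp, ?_⟩
    have hn : ((n : ℕ∞) : WithTop ℕ∞) ≤ (∞ : ℕ∞ω) := by exact_mod_cast le_top
    have h := ((((P.contDiffOn_G_one 0).of_le hn).comp ih c.mem).pow 2).inv
      fun t ht => (pow_pos (P.G_one_pos (c.mem t ht)) 2).ne'
    exact h.congr fun t ht => (c.hasDerivAt t ht).deriv

lemma contDiffOn_sol :
    ContDiffOn ℝ ∞ (fun p : ℝ × ℝ => sol H e p.1 p.2) (Icc 0 1 ×ˢ Ioo t₀ T) := by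
  have he : ContDiffOn ℝ ∞ (fun p : ℝ × ℝ => e p.2) (Icc 0 1 ×ˢ Ioo t₀ T) :=
    (c.contDiffOn P).comp contDiffOn_snd fun _ hp => hp.2
  have h1 : ContDiffOn ℝ ∞ (fun p : ℝ × ℝ => vel H (back H p.1 (e p.2)) (e p.2))
      (Icc 0 1 ×ˢ Ioo t₀ T) :=
    ContDiffOn.comp (g := fun q : ℝ × ℝ => vel H (back H q.1 q.2) q.2)
      (f := fun p : ℝ × ℝ => (p.1, e p.2)) P.contDiffOn_vel_back (contDiffOn_fst.prodMk he)
      fun p hp => ⟨hp.1, c.mem _ hp.2⟩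
  have h2 : ContDiffOn ℝ ∞ (fun p : ℝ × ℝ => G H 0 1 (e p.2)) (Icc 0 1 ×ˢ Ioo t₀ T) :=
    ContDiffOn.comp (g := fun η => G H 0 1 η) (P.contDiffOn_G_one 0) he fun p hp => c.mem _ hp.2
  exact h1.div (h2.pow 2) fun p hp => (pow_pos (P.G_one_pos (c.mem _ hp.2)) 2).ne'

lemma hasDerivAt_flow (α : ℝ) {t : ℝ} (ht : t ∈ Ioo t₀ T) :
    HasDerivAt (fun s => flow H α (e s)) (sol H e (flow H α (e t)) t) t := by
  refine ((P.hasDerivAt_flow_right α (c.mem t ht)).comp t (c.hasDerivAt t ht)).congr_deriv ?_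
  rw [sol, P.back_flow α (c.mem t ht), div_eq_mul_inv]

/-- The space derivative of the solution along the flow. -/
lemma ux_sol_flow {α : ℝ} (hα : α ∈ Icc (0 : ℝ) 1) {t : ℝ} (ht : t ∈ Ioo t₀ T) :
    ux (sol H e) (flow H α (e t)) t =
      (H α / (1 - e t * H α) - G H 1 1 (e t) / G H 0 1 (e t)) / G H 0 1 (e t) ^ 2 :=
  ((P.hasDerivAt_vel_back α (c.mem t ht)).div_const _).hasDerivWithinAt.derivWithin
    (uniqueDiffOn_Icc one_pos _ (P.flow_mem hα (c.mem t ht)))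

lemma sol_boundary {t : ℝ} (ht : t ∈ Ioo t₀ T) : sol H e 0 t = 0 ∧ sol H e 1 t = 0 := by
  have hm := c.mem t ht
  have h0 := P.back_flow 0 hm
  have h1 := P.back_flow 1 hm
  rw [P.flow_one hm] at h1
  rw [IsProfile.flow_zero] at h0
  simp [sol, h0, h1, P.vel_one hm]

/-- The left side is the material derivative of `u_x` minus `u_x²`. In terms of the explicit formula
along a trajectory, all terms containing `H α` cancel, and what remains depends on `t` only. -/
lemma equation_forcing {x : ℝ} (hx : x ∈ Icc (0 : ℝ) 1) {t : ℝ} (ht : t ∈ Ioo t₀ T) :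
    uxt (sol H e) x t + sol H e x t * uxx (sol H e) x t - ux (sol H e) x t ^ 2 =
      -forcing H (e t) := by
  have hm := c.mem t ht
  obtain ⟨α, hα, hαx⟩ := P.exists_flow_eq hx hm
  have cs := contDiffOn_ux (c.contDiffOn_sol P) isOpen_Ioo.uniqueDiffOn
  have hF := hasFDerivWithinAt_strip cs hx ht
  set L := fderivWithin ℝ (fun p : ℝ × ℝ => ux (sol H e) p.1 p.2) (Icc 0 1 ×ˢ Ioo t₀ T) (x, t)
    with hL
  have hxx : uxx (sol H e) x t = L (1, 0) := ux_eq_fderivWithin cs hx ht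
  have hxt : uxt (sol H e) x t = L (0, 1) := (hasDerivAt_time cs isOpen_Ioo hx ht).deriv
  have hflow := c.hasDerivAt_flow P α ht
  have hcurve : HasDerivAt (fun s => ux (sol H e) (flow H α (e s)) s) (L (sol H e x t, 1)) t := by
    have hF' : HasFDerivWithinAt (fun p : ℝ × ℝ => ux (sol H e) p.1 p.2) L
        (Icc 0 1 ×ˢ Ioo t₀ T) (flow H α (e t), t) := by rwa [hαx]
    have h := hF'.comp_hasDerivWithinAt t (f := fun s : ℝ => ((flow H α (e s), s) : ℝ × ℝ))
      (hflow.prodMk (hasDerivAt_id t)).hasDerivWithinAt (s := Ioo t₀ T)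
      fun s hs => ⟨P.flow_mem hα (c.mem s hs), hs⟩
    rw [hαx] at h
    exact h.hasDerivAt (isOpen_Ioo.mem_nhds ht)
  have hlin : L (sol H e x t, 1) = sol H e x t * L (1, 0) + L (0, 1) := by
    have : ((sol H e x t, 1) : ℝ × ℝ) = sol H e x t • ((1, 0) : ℝ × ℝ) + (0, 1) := by simp
    rw [this, map_add, map_smul, smul_eq_mul]
  have hK := (P.G_one_pos hm).ne'
  have hJ := (P.pos _ hm α).ne'
  have de := c.hasDerivAt t ht
  have dK := (P.hasDerivAt_G_zero hm).comp t de
  have dK1 := (P.hasDerivAt_G_one_one hm).comp t de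
  have dJ := (de.mul_const (H α)).const_sub 1
  have hW := ((((hasDerivAt_const t (H α)).div dJ hJ).sub (dK1.div dK hK)).div (dK.pow 2)
    (pow_ne_zero 2 hK))
  have hEq : (fun s => ux (sol H e) (flow H α (e s)) s) =ᶠ[𝓝 t]
      fun s => (H α / (1 - e s * H α) - G H 1 1 (e s) / G H 0 1 (e s)) / G H 0 1 (e s) ^ 2 := by
    filter_upwards [isOpen_Ioo.mem_nhds ht] with s hs using c.ux_sol_flow P hα hs
  -- The same derivative is computed twice: by the chain rule, as `u_xt + u u_xx`, and from the
  -- explicit formula.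
  have huniq := hcurve.unique (HasDerivAt.congr_of_eventuallyEq hW hEq)
  have hux := c.ux_sol_flow P hα ht
  rw [hαx] at hux
  rw [hxx, hxt, hux, add_comm, ← hlin, huniq, forcing]
  simp only [Function.comp_apply, Pi.sub_apply, Pi.div_apply, Pi.pow_apply]
  generalize G H 0 1 (e t) = K at hK ⊢
  generalize hj : 1 - e t * H α = J at hJ ⊢
  field_simp
  ring

/-- The forcing is the nonlocal term of the equation. -/
lemma forcing_eq {t : ℝ} (ht : t ∈ Ioo t₀ T) :
    forcing H (e t) = 2 * ∫ y in (0 : ℝ)..1, ux (sol H e) y t ^ 2 := by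
  have c0 := c.contDiffOn_sol P
  have c1 := contDiffOn_ux c0 isOpen_Ioo.uniqueDiffOn
  have c2 := contDiffOn_ux c1 isOpen_Ioo.uniqueDiffOn
  have s0 := continuousOn_slice c0 ht
  have s1 := continuousOn_slice c1 ht
  have s2 : ContinuousOn (fun y => uxx (sol H e) y t) (Icc 0 1) := continuousOn_slice c2 ht
  have s3 : ContinuousOn (fun y => uxt (sol H e) y t) (Icc 0 1) :=
    continuousOn_slice (contDiffOn_deriv_time c1 isOpen_Ioo) ht
  have ii : ∀ {g : ℝ → ℝ}, ContinuousOn g (Icc 0 1) → IntervalIntegrable g volume 0 1 :=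
    fun hg => ContinuousOn.intervalIntegrable (by rwa [uIcc_of_le zero_le_one])
  -- By the boundary conditions `u_x` has mean zero at all times, so its time derivative has mean
  -- zero as well.
  have h1 : ∫ y in (0 : ℝ)..1, uxt (sol H e) y t = 0 := by
    refine (hasDerivAt_integral_strip c1 isOpen_Ioo ht).unique
      ((hasDerivAt_const t (0 : ℝ)).congr_of_eventuallyEq ?_)
    filter_upwards [isOpen_Ioo.mem_nhds ht] with s hs
    rw [integral_eq_sub_of_hasDerivWithinAt (fun y hy => hasDerivWithinAt_ux c0 hy hs)
      (continuousOn_slice c1 hs) (right_mem_Icc.2 zero_le_one)]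
    simp [c.sol_boundary P hs]
  have h2 : ∫ y in (0 : ℝ)..1, (ux (sol H e) y t * ux (sol H e) y t +
      sol H e y t * uxx (sol H e) y t) = 0 := by
    rw [integral_eq_sub_of_hasDerivWithinAt (f := fun y => sol H e y t * ux (sol H e) y t)
      (f' := fun y => ux (sol H e) y t * ux (sol H e) y t + sol H e y t * uxx (sol H e) y t)
      (fun y hy => (hasDerivWithinAt_ux c0 hy ht).mul (hasDerivWithinAt_ux c1 hy ht))
      (by fun_prop) (right_mem_Icc.2 zero_le_one)]
    simp [c.sol_boundary P ht]
  -- Since `u u_xx - u_x² = (u u_x)_x - 2 u_x²`, integrating the equation over `[0,1]` leaves only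
  -- `-2 ∫ u_x²` on the left.
  have h3 : ∫ y in (0 : ℝ)..1, (uxt (sol H e) y t + (ux (sol H e) y t * ux (sol H e) y t +
      sol H e y t * uxx (sol H e) y t) - 2 * ux (sol H e) y t ^ 2) =
      ∫ _y in (0 : ℝ)..1, -forcing H (e t) := by
    refine intervalIntegral.integral_congr fun y hy => ?_
    rw [uIcc_of_le zero_le_one] at hy
    have := c.equation_forcing P hy ht
    linear_combination this
  rw [intervalIntegral.integral_sub, intervalIntegral.integral_add, h1, h2,
    intervalIntegral.integral_const_mul, intervalIntegral.integral_const] at h3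
  · simp only [sub_zero, smul_eq_mul, one_mul] at h3
    linarith
  all_goals exact ii (by fun_prop)

lemma isSmoothSolution {u₀ : ℝ → ℝ} (hu₀ : ContDiffOn ℝ ∞ u₀ (Icc 0 1)) (h0 : u₀ 0 = 0)
    (h1 : u₀ 1 = 0) (hH : ∀ x ∈ Icc (0 : ℝ) 1, H x = dI u₀ x) (hT : 0 < T) :
    IsSmoothSolution u₀ T (sol H e) where
  smooth := (c.contDiffOn_sol P).mono (prod_mono le_rfl c.Ico_subset)
  equation x hx t ht := by
    have ht' := c.Ico_subset (Ioo_subset_Ico_self ht)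
    rw [c.equation_forcing P hx ht', c.forcing_eq P ht', neg_mul]
  initial x hx := by
    have hm : (0 : ℝ) ∈ D := by
      have := c.mem 0 ⟨c.neg, hT⟩
      rwa [c.zero] at this
    have hg := fun α hα => G_one_zero hu₀ h0 hH (α := α) hα
    have hb : back H x 0 = x := by
      have := P.back_flow x hm
      rwa [flow, G_zero_zero, G_zero_zero, div_one] at this
    rw [sol, c.zero, hb, vel, G_zero_zero, G_zero_zero, hg x hx,
      hg 1 (right_mem_Icc.2 zero_le_one), h1]
    simp
  boundary t ht := c.sol_boundary P (c.Ico_subset ht)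

lemma isFlow : IsFlow T (sol H e) fun α t => flow H α (e t) where
  initial α _ := by simp [c.zero, flow, G]
  mem α hα t ht := P.flow_mem hα (c.mem t (c.Ico_subset ht))
  ode α _ t ht := (c.hasDerivAt_flow P α (c.Ico_subset ht)).hasDerivWithinAt

/-- Here `φ = K_0 ∘ e` and `φ' = K_1(e) / K_0(e)²`; then `φ'' / φ` is `forcing`, already identified
with the nonlocal term. -/
lemma isRescaledTime (h0 : G H 1 1 0 = 0) : IsRescaledTime T (sol H e) e := by
  refine ⟨fun t => G H 0 1 (e t), fun t => G H 1 1 (e t) / G H 0 1 (e t) ^ 2, ?_, ?_,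
    fun t ht => ?_, fun t ht => ?_, fun t ht => ?_⟩
  · simp [c.zero, G_zero_zero]
  · simp [c.zero, h0]
  · have hm := c.mem t (c.Ico_subset ht)
    exact (((P.hasDerivAt_G_zero hm).comp t
      (c.hasDerivAt t (c.Ico_subset ht))).congr_deriv (div_eq_mul_inv _ _).symm).hasDerivWithinAt
  · have ht' := c.Ico_subset ht
    have hm := c.mem t ht'
    have hK := (P.G_one_pos hm).ne'
    have dK := (P.hasDerivAt_G_zero hm).comp t (c.hasDerivAt t ht')
    have dK1 := (P.hasDerivAt_G_one_one hm).comp t (c.hasDerivAt t ht')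
    refine ((dK1.div (dK.pow 2) (pow_ne_zero 2 hK)).congr_deriv ?_).hasDerivWithinAt
    rw [← c.forcing_eq P ht', forcing]
    simp only [Function.comp_apply, Pi.pow_apply]
    field_simp
    ring
  · have hsub : uIcc 0 t ⊆ Ioo t₀ T := by
      rw [uIcc_of_le ht.1]
      exact fun s hs => c.Ico_subset ⟨hs.1, hs.2.trans_lt ht.2⟩
    rw [intervalIntegral.integral_eq_sub_of_hasDerivAt (f := e)
      (fun s hs => c.hasDerivAt s (hsub hs)), c.zero, sub_zero]
    refine ContinuousOn.intervalIntegrable ?_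
    have h1 : ContinuousOn (fun s => G H 0 1 (e s)) (uIcc 0 t) :=
      ((P.contDiffOn_G_one 0).comp (c.contDiffOn P) c.mem).continuousOn.mono hsub
    exact (h1.pow 2).inv₀ fun s hs => (pow_pos (P.G_one_pos (c.mem s (hsub hs))) 2).ne'

end IsClock

end NonlocalBlowup

namespace NonlocalBlowup

/-! ### Asymptotics of the integrals -/

lemma tendsto_sub_nhdsLT (a : ℝ) : Tendsto (fun x => a - x) (𝓝[<] a) (𝓝[>] 0) := by
  refine tendsto_nhdsWithin_iff.2 ⟨?_, ?_⟩
  · have : Tendsto (fun x => a - x) (𝓝 a) (𝓝 (a - a)) := tendsto_const_nhds.sub tendsto_id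
    rw [sub_self] at this
    exact this.mono_left nhdsWithin_le_nhds
  · filter_upwards [self_mem_nhdsWithin] with x hx
    exact sub_pos.2 (mem_Iio.1 hx)

lemma tendsto_neg_log_sub (a : ℝ) :
    Tendsto (fun x => -Real.log (a - x)) (𝓝[<] a) atTop :=
  tendsto_neg_atBot_atTop.comp (Real.tendsto_log_nhdsGT_zero.comp (tendsto_sub_nhdsLT a))

lemma tendsto_sub_mul_log (a : ℝ) :
    Tendsto (fun x => (a - x) * -Real.log (a - x)) (𝓝[<] a) (𝓝 0) := by
  have h := (Real.continuous_mul_log.tendsto 0).mono_left (nhdsWithin_le_nhds (s := Ioi 0))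
  simpa using (h.comp (tendsto_sub_nhdsLT a)).neg

lemma integral_inv_affine {p q b : ℝ} (hp : 0 < p) (hq : 0 < q) (hb : 0 ≤ b) :
    ∫ s in (0 : ℝ)..b, 1 / (p * s + q) = (Real.log (p * b + q) - Real.log q) / p := by
  have hpos : ∀ s ∈ uIcc 0 b, 0 < p * s + q := fun s hs => by
    rw [uIcc_of_le hb] at hs
    have := mul_nonneg hp.le hs.1
    linarith
  rw [intervalIntegral.integral_eq_sub_of_hasDerivAt (f := fun s => Real.log (p * s + q) / p) ?_ ?_]
  · simp [sub_div]
  · intro s hs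
    have := ((((hasDerivAt_id s).const_mul p).add_const q).log (hpos s hs).ne').div_const p
    refine this.congr_deriv ?_
    have := (hpos s hs).ne'
    simp only [id, mul_one]
    field_simp
  · exact ContinuousOn.intervalIntegrable
      (continuousOn_const.div (by fun_prop) fun s hs => (hpos s hs).ne')

lemma integral_inv_sq_affine {p q b : ℝ} (hp : 0 < p) (hq : 0 < q) (hb : 0 ≤ b) :
    ∫ s in (0 : ℝ)..b, 1 / (p * s + q) ^ 2 = (1 / q - 1 / (p * b + q)) / p := by
  have hpos : ∀ s ∈ uIcc 0 b, 0 < p * s + q := fun s hs => by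
    rw [uIcc_of_le hb] at hs
    have := mul_nonneg hp.le hs.1
    linarith
  rw [intervalIntegral.integral_eq_sub_of_hasDerivAt (f := fun s => -(p * s + q)⁻¹ / p) ?_ ?_]
  · simp; ring
  · intro s hs
    have := ((((hasDerivAt_id s).const_mul p).add_const q).inv (hpos s hs).ne').neg.div_const p
    refine this.congr_deriv ?_
    have := (hpos s hs).ne'
    simp only [id, mul_one]
    field_simp
  · exact ContinuousOn.intervalIntegrable
      (continuousOn_const.div (by fun_prop) fun s hs => (pow_pos (hpos s hs) 2).ne')

/-- `1/(1-ηk)` and its linear model differ by a bounded amount. -/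
lemma abs_inv_sub_inv_le {η E D s c m C : ℝ} (hη : 0 < η) (hE : 0 < E) (hs : 0 ≤ s) (hc : 0 < c)
    (hm : 0 < m) (hC : 0 ≤ C) (hD : m * s ≤ D) (hDc : |D - c * s| ≤ C * s ^ 2) :
    |1 / (η * D + E) - 1 / (η * c * s + E)| ≤ C / (η * m * c) := by
  have hD0 : 0 ≤ D := (mul_nonneg hm.le hs).trans hD
  have h1 : 0 < η * D + E := by positivity
  have h2 : 0 < η * c * s + E := by positivity
  have h3 : 1 / (η * D + E) - 1 / (η * c * s + E) =
      -(η * (D - c * s)) / ((η * D + E) * (η * c * s + E)) := by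
    field_simp; ring
  rw [h3, abs_div, abs_neg, abs_mul, abs_of_pos hη, abs_of_pos (mul_pos h1 h2),
    div_le_div_iff₀ (mul_pos h1 h2) (by positivity)]
  -- Dropping `E` from both denominators leaves a multiple of `s²`, which absorbs the quadratic
  -- error uniformly in `E`.
  have h4 : (η * m * s) * (η * c * s) ≤ (η * D + E) * (η * c * s + E) := by
    refine mul_le_mul ?_ (by linarith) (by positivity) h1.le
    nlinarith [mul_le_mul_of_nonneg_left hD hη.le]
  calc η * |D - c * s| * (η * m * c) ≤ η * (C * s ^ 2) * (η * m * c) := by gcongr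
    _ = C * ((η * m * s) * (η * c * s)) := by ring
    _ ≤ _ := by gcongr

/-- The contribution of an endpoint at which the maximum `M` is attained. -/
lemma tendsto_integrals_of_linear {k : ℝ → ℝ} {M b c m C : ℝ} (hM : 0 < M) (hb : 0 < b)
    (hk : ContinuousOn k (Icc 0 b)) (hc : 0 < c) (hm : 0 < m) (hC : 0 ≤ C)
    (hlow : ∀ s ∈ Icc 0 b, m * s ≤ M - k s)
    (hlin : ∀ s ∈ Icc 0 b, |M - k s - c * s| ≤ C * s ^ 2) :
    Tendsto (fun η => (∫ s in (0 : ℝ)..b, 1 / (1 - η * k s)) / -Real.log (1 / M - η))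
      (𝓝[<] (1 / M)) (𝓝 (M * (1 / c))) ∧
    Tendsto (fun η => (1 / M - η) * ∫ s in (0 : ℝ)..b, 1 / (1 - η * k s) ^ 2)
      (𝓝[<] (1 / M)) (𝓝 (1 / c)) := by
  have hM' : 0 < 1 / M := one_div_pos.2 hM
  set l := 𝓝[<] (1 / M) with hl
  set F₁ : ℝ → ℝ := fun η => ∫ s in (0 : ℝ)..b, 1 / (1 - η * k s) with hF₁
  set F₂ : ℝ → ℝ := fun η => ∫ s in (0 : ℝ)..b, 1 / (1 - η * k s) ^ 2 with hF₂
  set L₁ : ℝ → ℝ := fun η => ∫ s in (0 : ℝ)..b, 1 / (η * c * s + (1 / M - η) * M) with hL₁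
  set L₂ : ℝ → ℝ := fun η => ∫ s in (0 : ℝ)..b, 1 / (η * c * s + (1 / M - η) * M) ^ 2 with hL₂
  set B := C / (1 / M / 2 * m * c) with hB
  have hB0 : 0 ≤ B := by positivity
  -- Staying above half of `1 / M` makes the constant `B` independent of `η`.
  have hev : ∀ᶠ η in l, η ∈ Ioo (1 / M / 2) (1 / M) := Ioo_mem_nhdsLT (by linarith)
  have tη : Tendsto (fun η : ℝ => η) l (𝓝 (1 / M)) := nhdsWithin_le_nhds
  have tε : Tendsto (fun η : ℝ => 1 / M - η) l (𝓝 0) :=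
    (tendsto_sub_nhdsLT (1 / M)).mono_right nhdsWithin_le_nhds
  have tlog : Tendsto (fun η => -Real.log (1 / M - η)) l atTop := tendsto_neg_log_sub (1 / M)
  have hlogpos : ∀ᶠ η in l, 0 < -Real.log (1 / M - η) := tlog.eventually_gt_atTop 0
  have hcmp : ∀ η ∈ Ioo (1 / M / 2) (1 / M),
      |F₁ η - L₁ η| ≤ B * b ∧ |F₂ η - L₂ η| ≤ B * (F₁ η + L₁ η) := by
    intro η hη
    have hη0 : 0 < η := by linarith [hη.1]
    have hE : 0 < (1 / M - η) * M := mul_pos (by linarith [hη.2]) hM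
    -- The denominator splits into the part governed by `M - k` and the gap `(1 / M - η) M`;
    -- replacing `M - k s` by `c s` gives the affine model.
    have hJ : ∀ s, 1 - η * k s = η * (M - k s) + (1 / M - η) * M := fun s => by field_simp; ring
    have hJpos : ∀ s ∈ Icc 0 b, 0 < 1 - η * k s := fun s hs => by
      rw [hJ]
      have := mul_nonneg hη0.le ((mul_nonneg hm.le hs.1).trans (hlow s hs))
      linarith
    have hmpos : ∀ s ∈ Icc 0 b, 0 < η * c * s + (1 / M - η) * M := fun s hs => by
      have := hs.1
      positivity
    have cJ : ContinuousOn (fun s => 1 / (1 - η * k s)) (Icc 0 b) :=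
      continuousOn_const.div (by fun_prop) fun s hs => (hJpos s hs).ne'
    have cm : ContinuousOn (fun s => 1 / (η * c * s + (1 / M - η) * M)) (Icc 0 b) :=
      continuousOn_const.div (by fun_prop) fun s hs => (hmpos s hs).ne'
    have cJ2 : ContinuousOn (fun s => 1 / (1 - η * k s) ^ 2) (Icc 0 b) :=
      continuousOn_const.div (by fun_prop) fun s hs => (pow_pos (hJpos s hs) 2).ne'
    have cm2 : ContinuousOn (fun s => 1 / (η * c * s + (1 / M - η) * M) ^ 2) (Icc 0 b) :=
      continuousOn_const.div (by fun_prop) fun s hs => (pow_pos (hmpos s hs) 2).ne'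
    have ii : ∀ {g : ℝ → ℝ}, ContinuousOn g (Icc 0 b) → IntervalIntegrable g volume 0 b :=
      fun hg => ContinuousOn.intervalIntegrable (by rwa [uIcc_of_le hb.le])
    have hpt : ∀ s ∈ Icc 0 b,
        |1 / (1 - η * k s) - 1 / (η * c * s + (1 / M - η) * M)| ≤ B := fun s hs => by
      rw [hJ]
      refine (abs_inv_sub_inv_le hη0 hE hs.1 hc hm hC (hlow s hs) (hlin s hs)).trans ?_
      rw [hB]
      gcongr
      exact hη.1.le
    constructor
    · rw [hF₁, hL₁]
      simp only
      rw [← intervalIntegral.integral_sub (ii cJ) (ii cm)]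
      have := intervalIntegral.norm_integral_le_of_norm_le_const (a := 0) (b := b) (C := B)
        (f := fun s => 1 / (1 - η * k s) - 1 / (η * c * s + (1 / M - η) * M)) fun s hs =>
        hpt s (by rw [uIoc_of_le hb.le] at hs; exact Ioc_subset_Icc_self hs)
      simpa [abs_of_pos hb] using this
    · rw [hF₂, hL₂, hF₁, hL₁]
      simp only
      -- The difference of squares factors: the difference is at most `B`, and the sum integrates to
      -- `F₁ + L₁`.
      rw [← intervalIntegral.integral_sub (ii cJ2) (ii cm2),
        ← intervalIntegral.integral_add (ii cJ) (ii cm), ← intervalIntegral.integral_const_mul]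
      refine (intervalIntegral.abs_integral_le_integral_abs hb.le).trans ?_
      refine intervalIntegral.integral_mono_on hb.le (ii (by fun_prop)) (ii (by fun_prop))
        fun s hs => ?_
      have h1 := one_div_pos.2 (hJpos s hs)
      have h2 := one_div_pos.2 (hmpos s hs)
      rw [← one_div_pow, ← one_div_pow, sq_sub_sq, abs_mul, abs_of_pos (add_pos h1 h2), mul_comm]
      gcongr
      exact hpt s hs
  have tL₁ : Tendsto (fun η => L₁ η / -Real.log (1 / M - η)) l (𝓝 (M * (1 / c))) := by
    have h1 : Tendsto (fun η => ((Real.log (η * c * b + (1 / M - η) * M) - Real.log M) /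
        -Real.log (1 / M - η) + 1) / (η * c)) l (𝓝 ((0 + 1) / (1 / M * c))) := by
      refine Tendsto.div (Tendsto.add ?_ tendsto_const_nhds) (tη.mul_const c) (by positivity)
      refine Tendsto.div_atTop (a := Real.log (1 / M * c * b + 0 * M) - Real.log M) ?_ tlog
      refine Tendsto.sub (Tendsto.log ?_ (by positivity)) tendsto_const_nhds
      exact ((tη.mul_const c).mul_const b).add (tε.mul_const M)
    have e1 : (0 + 1) / (1 / M * c) = M * (1 / c) := by field_simp; ring
    rw [e1] at h1
    refine h1.congr' ?_
    filter_upwards [hev, hlogpos] with η hη hlog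
    have hη0 : 0 < η := by linarith [hη.1]
    have hε : 0 < 1 / M - η := by linarith [hη.2]
    rw [hL₁]
    simp only
    rw [integral_inv_affine (by positivity) (by positivity) hb.le, Real.log_mul hε.ne' hM.ne']
    generalize Real.log (1 / M - η) = x at hlog ⊢
    have : x ≠ 0 := by rintro rfl; simp at hlog
    field_simp
    ring
  have tF₁ : Tendsto (fun η => F₁ η / -Real.log (1 / M - η)) l (𝓝 (M * (1 / c))) := by
    have h0 : Tendsto (fun η => (F₁ η - L₁ η) / -Real.log (1 / M - η)) l (𝓝 0) := by
      refine squeeze_zero_norm' ?_ (tendsto_const_nhds (x := B * b) |>.div_atTop tlog)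
      filter_upwards [hev, hlogpos] with η hη hlog
      rw [norm_div, Real.norm_eq_abs, Real.norm_eq_abs, abs_of_pos hlog]
      gcongr
      exact (hcmp η hη).1
    have := h0.add tL₁
    rw [zero_add] at this
    exact this.congr fun η => by ring
  refine ⟨tF₁, ?_⟩
  have tL₂ : Tendsto (fun η => (1 / M - η) * L₂ η) l (𝓝 (1 / c)) := by
    have h1 : Tendsto (fun η => (1 / M - (1 / M - η) / (η * c * b + (1 / M - η) * M)) / (η * c)) l
        (𝓝 ((1 / M - 0 / (1 / M * c * b + 0 * M)) / (1 / M * c))) := by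
      refine Tendsto.div (tendsto_const_nhds.sub (tε.div ?_ (by positivity))) (tη.mul_const c)
        (by positivity)
      exact ((tη.mul_const c).mul_const b).add (tε.mul_const M)
    have e1 : (1 / M - 0 / (1 / M * c * b + 0 * M)) / (1 / M * c) = 1 / c := by
      rw [zero_div]; field_simp; ring
    rw [e1] at h1
    refine h1.congr' ?_
    filter_upwards [hev] with η hη
    have hη0 : 0 < η := by linarith [hη.1]
    have hε : 0 < 1 / M - η := by linarith [hη.2]
    rw [hL₂]
    simp only
    rw [integral_inv_sq_affine (by positivity) (by positivity) hb.le]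
    have h2 : 0 < η * c * b + (1 / M - η) * M := by positivity
    generalize 1 / M - η = ε at hε h2 ⊢
    have := hε.ne'
    have := h2.ne'
    field_simp
  -- The error is `O(F₁ + L₁)`, hence only logarithmic, and the factor `1 / M - η` kills it.
  have h0 : Tendsto (fun η => (1 / M - η) * (F₂ η - L₂ η)) l (𝓝 0) := by
    have h1 : Tendsto (fun η => B * ((F₁ η / -Real.log (1 / M - η) +
        L₁ η / -Real.log (1 / M - η)) * ((1 / M - η) * -Real.log (1 / M - η)))) l (𝓝 0) := by
      have := ((tF₁.add tL₁).mul (tendsto_sub_mul_log (1 / M))).const_mul B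
      simpa using this
    refine squeeze_zero_norm' ?_ h1
    filter_upwards [hev, hlogpos] with η hη hlog
    have hε : 0 < 1 / M - η := by linarith [hη.2]
    rw [norm_mul, Real.norm_eq_abs, Real.norm_eq_abs, abs_of_pos hε]
    refine (mul_le_mul_of_nonneg_left (hcmp η hη).2 hε.le).trans (le_of_eq ?_)
    have := hlog.ne'
    generalize -Real.log (1 / M - η) = x at this ⊢
    field_simp
  have := h0.add tL₂
  rw [zero_add] at this
  exact this.congr fun η => by ring

/-- The contribution of an endpoint at which the maximum `M` is not attained. -/
lemma tendsto_integrals_of_lt {k : ℝ → ℝ} {M b m : ℝ} (hM : 0 < M) (hb : 0 < b)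
    (hm : 0 < m) (hlow : ∀ s ∈ Icc 0 b, m ≤ M - k s) :
    Tendsto (fun η => (∫ s in (0 : ℝ)..b, 1 / (1 - η * k s)) / -Real.log (1 / M - η))
      (𝓝[<] (1 / M)) (𝓝 (M * 0)) ∧
    Tendsto (fun η => (1 / M - η) * ∫ s in (0 : ℝ)..b, 1 / (1 - η * k s) ^ 2)
      (𝓝[<] (1 / M)) (𝓝 0) := by
  have hM' : 0 < 1 / M := one_div_pos.2 hM
  have tlog := tendsto_neg_log_sub (1 / M)
  have tε : Tendsto (fun η : ℝ => 1 / M - η) (𝓝[<] (1 / M)) (𝓝 0) :=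
    (tendsto_sub_nhdsLT (1 / M)).mono_right nhdsWithin_le_nhds
  set B := 1 / (1 / M / 2 * m) with hB
  have hev : ∀ᶠ η in 𝓝[<] (1 / M), η ∈ Ioo (1 / M / 2) (1 / M) := Ioo_mem_nhdsLT (by linarith)
  have hpt : ∀ η ∈ Ioo (1 / M / 2) (1 / M), ∀ s ∈ Icc 0 b,
      0 ≤ 1 / (1 - η * k s) ∧ 1 / (1 - η * k s) ≤ B := by
    intro η hη s hs
    have hη0 : 0 < η := by linarith [hη.1]
    have hε : 0 < 1 / M - η := by linarith [hη.2]
    have hJ : 1 - η * k s = η * (M - k s) + (1 / M - η) * M := by field_simp; ring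
    have hle : 1 / M / 2 * m ≤ 1 - η * k s := by
      rw [hJ]
      have h1 := mul_le_mul hη.1.le (hlow s hs) hm.le hη0.le
      have h2 := mul_pos hε hM
      linarith
    have hpos : 0 < 1 / M / 2 * m := by positivity
    exact ⟨(one_div_pos.2 (hpos.trans_le hle)).le, one_div_le_one_div_of_le hpos hle⟩
  constructor
  · rw [mul_zero]
    refine squeeze_zero_norm' ?_ (tendsto_const_nhds (x := B * b) |>.div_atTop tlog)
    filter_upwards [hev, tlog.eventually_gt_atTop 0] with η hη hlog
    rw [norm_div, Real.norm_eq_abs (-Real.log _), abs_of_pos hlog]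
    gcongr
    have := intervalIntegral.norm_integral_le_of_norm_le_const (a := 0) (b := b) (C := B)
      (f := fun s => 1 / (1 - η * k s)) fun s hs => by
        have h := hpt η hη s (by rw [uIoc_of_le hb.le] at hs; exact Ioc_subset_Icc_self hs)
        rw [Real.norm_eq_abs, abs_of_nonneg h.1]
        exact h.2
    simpa [abs_of_pos hb] using this
  · have h1 : Tendsto (fun η => (1 / M - η) * (B ^ 2 * b)) (𝓝[<] (1 / M)) (𝓝 0) := by
      simpa using tε.mul_const (B ^ 2 * b)
    refine squeeze_zero_norm' ?_ h1
    filter_upwards [hev] with η hη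
    have hε : 0 < 1 / M - η := by linarith [hη.2]
    rw [norm_mul, Real.norm_eq_abs (1 / M - η), abs_of_pos hε]
    gcongr
    have := intervalIntegral.norm_integral_le_of_norm_le_const (a := 0) (b := b) (C := B ^ 2)
      (f := fun s => 1 / (1 - η * k s) ^ 2) fun s hs => by
        have h := hpt η hη s (by rw [uIoc_of_le hb.le] at hs; exact Ioc_subset_Icc_self hs)
        rw [← one_div_pow, norm_pow, Real.norm_eq_abs, abs_of_nonneg h.1]
        gcongr
        exacts [h.1, h.2]
    simpa [abs_of_pos hb] using this

end NonlocalBlowup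

namespace NonlocalBlowup

/-! ### Peaked profiles: endpoint maxima and divergence rates -/

lemma exists_abs_sub_linear_le {k : ℝ → ℝ} (hk : ContDiffOn ℝ ∞ k (Icc 0 1)) :
    ∃ C, 0 ≤ C ∧ ∀ s ∈ Icc (0 : ℝ) 1, |k s - k 0 - dI k 0 * s| ≤ C * s ^ 2 := by
  obtain ⟨C, hC⟩ := exists_taylor_mean_remainder_bound (n := 1) zero_le_one
    (by exact_mod_cast contDiffOn_infty.1 hk (1 + 1))
  refine ⟨max C 0, le_max_right _ _, fun s hs => ?_⟩
  have h := hC s hs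
  rw [taylorWithinEval_succ, taylor_within_zero_eval] at h
  simp only [CharP.cast_eq_zero, zero_add, Nat.factorial_zero, Nat.cast_one, mul_one, inv_one,
    sub_zero, pow_one, one_mul, iteratedDerivWithin_one, smul_eq_mul, Real.norm_eq_abs,
    Nat.reduceAdd] at h
  rw [show k s - k 0 - dI k 0 * s = k s - (k 0 + s * derivWithin k (Icc 0 1) 0) by
    rw [dI]; ring]
  exact h.trans (by gcongr; exact le_max_left _ _)

/-- The asymptotic contribution of the endpoint `0`, whether or not the maximum `M` is attained
there. -/
lemma tendsto_integrals_endpoint {k : ℝ → ℝ} {M : ℝ} (hM : 0 < M)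
    (hk : ContDiffOn ℝ ∞ k (Icc 0 1)) (hle : k 0 ≤ M) (hlt : ∀ s ∈ Ioo (0 : ℝ) 1, k s < M)
    (hne : k 0 = M → dI k 0 ≠ 0) :
    Tendsto (fun η => (∫ s in (0 : ℝ)..(1 / 2), 1 / (1 - η * k s)) / -Real.log (1 / M - η))
      (𝓝[<] (1 / M)) (𝓝 (M * if k 0 = M then 1 / |dI k 0| else 0)) ∧
    Tendsto (fun η => (1 / M - η) * ∫ s in (0 : ℝ)..(1 / 2), 1 / (1 - η * k s) ^ 2)
      (𝓝[<] (1 / M)) (𝓝 (if k 0 = M then 1 / |dI k 0| else 0)) := by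
  have hsub : ∀ {δ : ℝ}, 0 ≤ δ → Icc δ (1 / 2) ⊆ Icc (0 : ℝ) 1 := fun hδ =>
    Icc_subset_Icc hδ (by norm_num)
  have hmin : ∀ {δ : ℝ}, 0 ≤ δ → δ ≤ 1 / 2 → (∀ s ∈ Icc δ (1 / 2), k s < M) →
      ∃ μ, 0 < μ ∧ ∀ s ∈ Icc δ (1 / 2), μ ≤ M - k s := by
    intro δ hδ hδ' h
    obtain ⟨x, hx, hxmin⟩ := isCompact_Icc.exists_isMinOn (nonempty_Icc.2 hδ')
      (continuousOn_const.sub (hk.continuousOn.mono (hsub hδ)) : ContinuousOn (fun s => M - k s) _)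
    exact ⟨M - k x, sub_pos.2 (h x hx), fun s hs => hxmin hs⟩
  split_ifs with h0
  · obtain ⟨C, hC0, hC⟩ := exists_abs_sub_linear_le hk
    -- A positive slope `q` would push `k` above `M` at the test point `s = q / (q + C + 1)`, which
    -- lies in `(0,1)` and satisfies `C s < q`.
    have hneg : dI k 0 < 0 := by
      refine lt_of_le_of_ne (not_lt.1 fun hp => ?_) (hne h0)
      have hden : 0 < dI k 0 + C + 1 := by linarith
      have hs0 : 0 < dI k 0 / (dI k 0 + C + 1) := by positivity
      have hs1 : dI k 0 / (dI k 0 + C + 1) < 1 := by rw [div_lt_one hden]; linarith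
      have h1 := (abs_le.1 (hC _ ⟨hs0.le, hs1.le⟩)).1
      have h2 := hlt _ ⟨hs0, hs1⟩
      set s := dI k 0 / (dI k 0 + C + 1) with hs
      have h3 : s * (dI k 0 + C + 1) = dI k 0 := div_mul_cancel₀ _ hden.ne'
      have h4 : C * s ^ 2 < dI k 0 * s := by
        have : C * s < dI k 0 := by nlinarith [mul_pos hs0 hp]
        nlinarith
      linarith
    have hc : 0 < -dI k 0 := neg_pos.2 hneg
    have hlin : ∀ s ∈ Icc (0 : ℝ) (1 / 2), |M - k s - -dI k 0 * s| ≤ C * s ^ 2 := fun s hs => by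
      have := hC s (hsub le_rfl hs)
      rw [h0, ← abs_neg] at this
      convert this using 2
      ring
    -- Up to `δ` the quadratic error is at most half the linear drop; beyond `δ`, compactness keeps
    -- `M - k` above some `μ > 0`.
    set δ := min (1 / 2) (-dI k 0 / (2 * (C + 1))) with hδ
    have hδ0 : 0 < δ := lt_min (by norm_num) (by positivity)
    obtain ⟨μ, hμ, hμle⟩ := hmin hδ0.le (min_le_left _ _) fun s hs =>
      hlt s ⟨hδ0.trans_le hs.1, by linarith [hs.2]⟩
    have hlow : ∀ s ∈ Icc (0 : ℝ) (1 / 2), min (-dI k 0 / 2) μ * s ≤ M - k s := fun s hs => by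
      rcases le_total s δ with h | h
      · have h1 := (abs_le.1 (hlin s hs)).1
        have h2 : s * (2 * (C + 1)) ≤ -dI k 0 :=
          (le_div_iff₀ (by positivity)).1 (h.trans (min_le_right _ _))
        have h3 : min (-dI k 0 / 2) μ * s ≤ -dI k 0 / 2 * s :=
          mul_le_mul_of_nonneg_right (min_le_left _ _) hs.1
        nlinarith [mul_le_mul_of_nonneg_left h2 hs.1, hs.1, sq_nonneg s]
      · have h1 := hμle s ⟨h, hs.2⟩
        have h3 : min (-dI k 0 / 2) μ * s ≤ μ * s :=
          mul_le_mul_of_nonneg_right (min_le_right _ _) hs.1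
        nlinarith [hs.2]
    have := tendsto_integrals_of_linear hM (by norm_num : (0 : ℝ) < 1 / 2)
      (hk.continuousOn.mono (hsub le_rfl)) hc (lt_min (by positivity) hμ) hC0 hlow hlin
    rwa [← abs_of_neg hneg] at this
  · obtain ⟨μ, hμ, hμle⟩ := hmin le_rfl (by norm_num) fun s hs => by
      rcases hs.1.eq_or_lt with h | h
      · rw [← h]; exact lt_of_le_of_ne hle h0
      · exact hlt s ⟨h, by linarith [hs.2]⟩
    exact tendsto_integrals_of_lt hM (by norm_num) hμ hμle

/-- A continuous profile `H`, smooth on `[0,1]`, with maximum `M > 0` on `[0,1]`, attained exactly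
at the points of `A`, where `H' ≠ 0`. -/
structure IsPeaked (H : ℝ → ℝ) (M : ℝ) (A : Finset ℝ) : Prop where
  pos : 0 < M
  cont : Continuous H
  smooth : ContDiffOn ℝ ∞ H (Icc 0 1)
  le : ∀ s ∈ Icc (0 : ℝ) 1, H s ≤ M
  mem_iff : ∀ a, a ∈ A ↔ a ∈ Icc (0 : ℝ) 1 ∧ H a = M
  nonempty : A.Nonempty
  deriv_ne : ∀ a ∈ A, dI H a ≠ 0

namespace IsPeaked

variable {H : ℝ → ℝ} {M : ℝ} {A : Finset ℝ} (p : IsPeaked H M A)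

include p

/-- At an interior maximum the derivative would vanish, against `deriv_ne`. -/
lemma eq_zero_or_one {a : ℝ} (ha : a ∈ A) : a = 0 ∨ a = 1 := by
  obtain ⟨hI, hM⟩ := (p.mem_iff a).1 ha
  by_contra! h
  have hn : Icc (0 : ℝ) 1 ∈ 𝓝 a :=
    Icc_mem_nhds (lt_of_le_of_ne hI.1 h.1.symm) (lt_of_le_of_ne hI.2 h.2)
  refine p.deriv_ne a ha ?_
  rw [dI, derivWithin_of_mem_nhds hn]
  refine IsLocalMax.deriv_eq_zero ?_
  filter_upwards [hn] with s hs
  rw [hM]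
  exact p.le s hs

lemma lt {s : ℝ} (hs : s ∈ Ioo (0 : ℝ) 1) : H s < M := by
  refine lt_of_le_of_ne (p.le s (Ioo_subset_Icc_self hs)) fun h => ?_
  rcases p.eq_zero_or_one ((p.mem_iff s).2 ⟨Ioo_subset_Icc_self hs, h⟩) with h | h
  · exact hs.1.ne' h
  · exact hs.2.ne h

lemma sum_pos : 0 < ∑ b ∈ A, 1 / |dI H b| :=
  Finset.sum_pos (fun b hb => one_div_pos.2 (abs_pos.2 (p.deriv_ne b hb))) p.nonempty

lemma sum_eq : ∑ b ∈ A, 1 / |dI H b| =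
    (if H 0 = M then 1 / |dI H 0| else 0) + if H 1 = M then 1 / |dI H 1| else 0 := by
  classical
  have hA : A = ({0, 1} : Finset ℝ) ∩ A := by
    ext a
    simp only [Finset.mem_inter, Finset.mem_insert, Finset.mem_singleton]
    exact ⟨fun h => ⟨p.eq_zero_or_one h, h⟩, fun h => h.2⟩
  rw [hA, ← Finset.sum_ite_mem, Finset.sum_pair zero_ne_one]
  simp [p.mem_iff]

lemma one_sub_pos {η : ℝ} (hη : η ∈ Ico 0 (1 / M)) {s : ℝ} (hs : s ∈ Icc (0 : ℝ) 1) :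
    0 < 1 - η * H s := by
  have h1 := mul_le_mul_of_nonneg_left (p.le s hs) hη.1
  have h2 := (lt_div_iff₀ p.pos).1 hη.2
  linarith

/-- The interval is cut at `1 / 2` and the right half reflected by `s ↦ 1 - s`, so that both
endpoints fall under the same lemma; the reflection only changes the sign of the slope. -/
lemma tendsto_integrals :
    Tendsto (fun η => (∫ s in (0 : ℝ)..1, 1 / (1 - η * H s)) / -Real.log (1 / M - η))
      (𝓝[<] (1 / M)) (𝓝 (M * ∑ b ∈ A, 1 / |dI H b|)) ∧
    Tendsto (fun η => (1 / M - η) * ∫ s in (0 : ℝ)..1, 1 / (1 - η * H s) ^ 2)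
      (𝓝[<] (1 / M)) (𝓝 (∑ b ∈ A, 1 / |dI H b|)) := by
  have hmaps : MapsTo (fun s : ℝ => 1 - s) (Icc 0 1) (Icc 0 1) := fun s hs =>
    ⟨by linarith [hs.2], by linarith [hs.1]⟩
  have hd1 : dI (fun s => H (1 - s)) 0 = -dI H 1 := by
    have h1 : HasDerivWithinAt H (dI H 1) (Icc 0 1) 1 :=
      (p.smooth.differentiableOn (by simp) 1 (by simp)).hasDerivWithinAt
    have h2 : HasDerivWithinAt (fun s : ℝ => 1 - s) (-1) (Icc 0 1) 0 :=
      ((hasDerivAt_id (0 : ℝ)).const_sub 1).hasDerivWithinAt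
    have h3 := HasDerivWithinAt.comp (0 : ℝ) (h₂ := H) (h := fun s : ℝ => 1 - s)
      (by simpa using h1) h2 hmaps
    simpa using! h3.derivWithin (uniqueDiffOn_Icc one_pos 0 (by simp))
  have e0 := tendsto_integrals_endpoint p.pos p.smooth (p.le 0 (by simp)) (fun s hs => p.lt hs)
    fun h => p.deriv_ne 0 ((p.mem_iff 0).2 ⟨by simp, h⟩)
  have e1 := tendsto_integrals_endpoint (k := fun s => H (1 - s)) p.pos
    (p.smooth.comp (by fun_prop) hmaps) (p.le _ (by simp))
    (fun s hs => p.lt ⟨by linarith [hs.2], by linarith [hs.1]⟩)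
    fun h => by
      rw [hd1]
      exact neg_ne_zero.2 (p.deriv_ne 1 ((p.mem_iff 1).2 ⟨by simp, by simpa using h⟩))
  rw [hd1, abs_neg] at e1
  simp only [sub_zero] at e1
  have hsplit : ∀ n : ℕ, ∀ η ∈ Ioo 0 (1 / M), ∫ s in (0 : ℝ)..1, 1 / (1 - η * H s) ^ n =
      (∫ s in (0 : ℝ)..(1 / 2), 1 / (1 - η * H s) ^ n) +
        ∫ s in (0 : ℝ)..(1 / 2), 1 / (1 - η * H (1 - s)) ^ n := by
    intro n η hη
    have hc : ContinuousOn (fun s => 1 / (1 - η * H s) ^ n) (Icc 0 1) :=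
      continuousOn_const.div
        ((continuous_const.sub (continuous_const.mul p.cont)).pow n).continuousOn
        fun s hs => (pow_pos (p.one_sub_pos (Ioo_subset_Ico_self hη) hs) n).ne'
    have h2 : ∫ s in (0 : ℝ)..(1 / 2), 1 / (1 - η * H (1 - s)) ^ n =
        ∫ s in (1 / 2 : ℝ)..1, 1 / (1 - η * H s) ^ n := by
      rw [intervalIntegral.integral_comp_sub_left (fun s => 1 / (1 - η * H s) ^ n) 1]
      norm_num
    rw [h2, intervalIntegral.integral_add_adjacent_intervals]
    · refine ContinuousOn.intervalIntegrable (hc.mono ?_)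
      rw [uIcc_of_le (by norm_num)]
      exact Icc_subset_Icc_right (by norm_num)
    · refine ContinuousOn.intervalIntegrable (hc.mono ?_)
      rw [uIcc_of_le (by norm_num)]
      exact Icc_subset_Icc_left (by norm_num)
  have hev : ∀ᶠ η in 𝓝[<] (1 / M), η ∈ Ioo 0 (1 / M) := Ioo_mem_nhdsLT (one_div_pos.2 p.pos)
  rw [p.sum_eq]
  constructor
  · rw [mul_add]
    refine (e0.1.add e1.1).congr' ?_
    filter_upwards [hev] with η hη
    have := hsplit 1 η hη
    simp only [pow_one] at this
    rw [this, add_div]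
  · refine (e0.2.add e1.2).congr' ?_
    filter_upwards [hev] with η hη
    rw [hsplit 2 η hη, mul_add]

lemma tendsto_G_zero :
    Tendsto (fun η => G H 0 1 η / -Real.log (1 / M - η)) (𝓝[<] (1 / M))
      (𝓝 (M * ∑ b ∈ A, 1 / |dI H b|)) := by
  simpa [G] using p.tendsto_integrals.1

/-- From `η H = 1 - (1 - η H)`, `η K_1` is the integral of `(1 - η H)⁻²` minus that of `(1 - η
H)⁻¹`; the latter is only logarithmic. -/
lemma tendsto_G_one :
    Tendsto (fun η => (1 / M - η) * G H 1 1 η) (𝓝[<] (1 / M))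
      (𝓝 (M * ∑ b ∈ A, 1 / |dI H b|)) := by
  obtain ⟨t1, t2⟩ := p.tendsto_integrals
  have hM := p.pos
  have tη : Tendsto (fun η : ℝ => η) (𝓝[<] (1 / M)) (𝓝 (1 / M)) := nhdsWithin_le_nhds
  have t3 := (t2.sub (t1.mul (tendsto_sub_mul_log (1 / M)))).div tη (one_div_pos.2 hM).ne'
  rw [mul_zero, sub_zero, div_div_eq_mul_div, div_one, mul_comm _ M] at t3
  refine t3.congr' ?_
  filter_upwards [Ioo_mem_nhdsLT (one_div_pos.2 hM),
    (tendsto_neg_log_sub (1 / M)).eventually_gt_atTop 0] with η hη hlog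
  have hc : ∀ n : ℕ, IntervalIntegrable (fun s => 1 / (1 - η * H s) ^ n) volume 0 1 := fun n => by
    refine ContinuousOn.intervalIntegrable (continuousOn_const.div
      ((continuous_const.sub (continuous_const.mul p.cont)).pow n).continuousOn fun s hs => ?_)
    rw [uIcc_of_le zero_le_one] at hs
    exact (pow_pos (p.one_sub_pos (Ioo_subset_Ico_self hη) hs) n).ne'
  have key : η * G H 1 1 η = (∫ s in (0 : ℝ)..1, 1 / (1 - η * H s) ^ 2) -
      ∫ s in (0 : ℝ)..1, 1 / (1 - η * H s) := by
    have h1 : IntervalIntegrable (fun s => 1 / (1 - η * H s)) volume 0 1 := by simpa using hc 1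
    rw [← intervalIntegral.integral_sub (hc 2) h1, G, ← intervalIntegral.integral_const_mul]
    refine intervalIntegral.integral_congr fun s hs => ?_
    rw [uIcc_of_le zero_le_one] at hs
    have := (p.one_sub_pos (Ioo_subset_Ico_self hη) hs).ne'
    simp only [pow_one, Nat.reduceAdd]
    field_simp
    ring
  have hη0 := hη.1.ne'
  rw [show G H 1 1 η = (η * G H 1 1 η) / η by field_simp, key]
  simp only [Pi.div_apply]
  have := hlog.ne'
  generalize -Real.log (1 / M - η) = x at this ⊢
  field_simp

end IsPeaked

end NonlocalBlowup

namespace NonlocalBlowup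

/-! ### The rescaled time -/

lemma integral_log_sq {x : ℝ} (hx : 0 ≤ x) :
    ∫ s in (0 : ℝ)..x, Real.log s ^ 2 = x * Real.log x ^ 2 - 2 * (x * Real.log x) + 2 * x := by
  have hcont : ContinuousOn
      (fun x : ℝ => x * Real.log x ^ 2 - 2 * (x * Real.log x) + 2 * x) (Icc 0 x) := by
    -- Continuity at `0` comes from writing `x ln² x = (2 √x ln √x)²`, since `y ln y` is continuous.
    have h : Continuous fun x : ℝ =>
        (2 * (√x * Real.log √x)) ^ 2 - 2 * (x * Real.log x) + 2 * x := by
      have := Real.continuous_mul_log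
      have h2 : Continuous fun x : ℝ => √x * Real.log √x := this.comp Real.continuous_sqrt
      fun_prop
    refine h.continuousOn.congr fun y hy => ?_
    simp only
    rw [Real.log_sqrt hy.1]
    have := Real.sq_sqrt hy.1
    linear_combination -(Real.log y ^ 2) * this
  have hder : ∀ y ∈ Ioo 0 x, HasDerivAt
      (fun x : ℝ => x * Real.log x ^ 2 - 2 * (x * Real.log x) + 2 * x) (Real.log y ^ 2) y := by
    intro y hy
    have hl := Real.hasDerivAt_log hy.1.ne'
    have hy0 := hy.1.ne'
    have h := (((hasDerivAt_id y).mul (hl.pow 2)).sub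
      (((hasDerivAt_id y).mul hl).const_mul 2)).add ((hasDerivAt_id y).const_mul 2)
    refine HasDerivAt.congr_deriv (f := fun x : ℝ =>
      x * Real.log x ^ 2 - 2 * (x * Real.log x) + 2 * x) h ?_
    simp only [id, Pi.pow_apply, Nat.cast_ofNat, Nat.add_one_sub_one, pow_one]
    field_simp
    ring
  rw [intervalIntegral.integral_eq_sub_of_hasDerivAt_of_le hx hcont hder]
  · simp
  · rw [intervalIntegrable_iff_integrableOn_Ioc_of_le hx]
    exact intervalIntegral.integrableOn_deriv_of_nonneg hcont hder fun _ _ => sq_nonneg _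

lemma integral_log_sub_sq {a η : ℝ} (hη : η ≤ a) :
    ∫ μ in η..a, Real.log (a - μ) ^ 2 =
      (a - η) * Real.log (a - η) ^ 2 - 2 * ((a - η) * Real.log (a - η)) + 2 * (a - η) := by
  rw [intervalIntegral.integral_comp_sub_left (fun s => Real.log s ^ 2) a, sub_self,
    integral_log_sq (sub_nonneg.2 hη)]

lemma integral_log_sub_sq_pos {a η : ℝ} (hη : η < a) :
    0 < ∫ μ in η..a, Real.log (a - μ) ^ 2 := by
  rw [integral_log_sub_sq hη.le]
  have h := sub_pos.2 hη
  -- With `d = a - η`, the expression is `d ((ln d - 1)² + 1)`.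
  nlinarith [mul_nonneg h.le (sq_nonneg (Real.log (a - η) - 1))]

lemma hasDerivAt_integral_log_sub_sq {a η : ℝ} (hη : η < a) :
    HasDerivAt (fun η => ∫ μ in η..a, Real.log (a - μ) ^ 2) (-Real.log (a - η) ^ 2) η := by
  have hs : HasDerivAt (fun η => a - η) (-1) η := (hasDerivAt_id η).const_sub a
  have h0 := (sub_pos.2 hη).ne'
  have hl := hs.log h0
  have h := ((hs.mul (hl.pow 2)).sub ((hs.mul hl).const_mul 2)).add (hs.const_mul 2)
  refine (HasDerivAt.congr_deriv h ?_).congr_of_eventuallyEq ?_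
  · simp only [Pi.pow_apply, Nat.cast_ofNat, Nat.add_one_sub_one, pow_one]
    field_simp
    ring
  · filter_upwards [Iio_mem_nhds hη] with x hx using integral_log_sub_sq (mem_Iio.1 hx).le

/-- With `y = -ln (a - x)` this is `exp y / y ^ n`. -/
lemma tendsto_one_div_mul_log_pow (a : ℝ) (n : ℕ) :
    Tendsto (fun x => 1 / ((a - x) * (-Real.log (a - x)) ^ n)) (𝓝[<] a) atTop := by
  refine ((Real.tendsto_exp_div_pow_atTop n).comp (tendsto_neg_log_sub a)).congr' ?_
  filter_upwards [self_mem_nhdsWithin] with x hx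
  have hx' : 0 < a - x := sub_pos.2 (mem_Iio.1 hx)
  rw [Function.comp_apply, Real.exp_neg, Real.exp_log hx', one_div, mul_inv, div_eq_mul_inv]

lemma tendsto_integral_log_sub_sq (a : ℝ) :
    Tendsto (fun η => ∫ μ in η..a, Real.log (a - μ) ^ 2) (𝓝[<] a) (𝓝 0) := by
  have h1 := (tendsto_one_div_mul_log_pow a 2).inv_tendsto_atTop
  have h2 := tendsto_sub_mul_log a
  have h3 : Tendsto (fun η : ℝ => a - η) (𝓝[<] a) (𝓝 0) :=
    (tendsto_sub_nhdsLT a).mono_right nhdsWithin_le_nhds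
  have h4 := (h1.add (h2.const_mul 2)).add (h3.const_mul 2)
  simp only [mul_zero, add_zero] at h4
  refine h4.congr' ?_
  filter_upwards [self_mem_nhdsWithin] with x hx
  rw [integral_log_sub_sq (mem_Iio.1 hx).le]
  simp only [Pi.inv_apply, one_div, inv_inv]
  ring

namespace IsPeaked

variable {H : ℝ → ℝ} {M : ℝ} {A : Finset ℝ} (p : IsPeaked H M A)

include p

lemma tendsto_G_zero_atTop : Tendsto (fun η => G H 0 1 η) (𝓝[<] (1 / M)) atTop := by
  have h := p.tendsto_G_zero.pos_mul_atTop (mul_pos p.pos p.sum_pos) (tendsto_neg_log_sub (1 / M))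
  refine h.congr' ?_
  filter_upwards [(tendsto_neg_log_sub (1 / M)).eventually_gt_atTop 0] with η hη
  exact div_mul_cancel₀ _ hη.ne'

/-- Existence of the rescaled time, and its asymptotics at the (finite) blow-up time. -/
theorem exists_isClock {δ : ℝ} (hδ : 0 < δ) (P : IsProfile H (Ioo (-δ) (1 / M))) :
    ∃ t₀ T : ℝ, ∃ e : ℝ → ℝ, 0 < T ∧ IsClock H (Ioo (-δ) (1 / M)) t₀ T e ∧
      (∀ t ∈ Ico 0 T, 0 ≤ e t) ∧ Tendsto e (𝓝[<] T) (𝓝[<] (1 / M)) ∧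
      (fun t => T - t) ~[𝓝[<] T] (fun t => (M * ∑ b ∈ A, 1 / |dI H b|) ^ 2 *
        ∫ μ in (e t)..(1 / M), Real.log (1 / M - μ) ^ 2) := by
  set D := Ioo (-δ) (1 / M) with hD
  set c := M * ∑ b ∈ A, 1 / |dI H b| with hc
  have hc0 : 0 < c := mul_pos p.pos p.sum_pos
  have hM' : 0 < 1 / M := one_div_pos.2 p.pos
  have h0D : (0 : ℝ) ∈ D := ⟨neg_lt_zero.2 hδ, hM'⟩
  have hKc : ContinuousOn (fun η => G H 0 1 η ^ 2) D := (P.contDiffOn_G_one 0).continuousOn.pow 2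
  -- `τ` is physical time as a function of rescaled time; the clock `e` is its inverse and the
  -- blow-up time is its limit at `1 / M`.
  set τ : ℝ → ℝ := fun η => ∫ μ in (0 : ℝ)..η, G H 0 1 μ ^ 2 with hτ
  have hτ0 : τ 0 = 0 := intervalIntegral.integral_same
  have dτ : ∀ η ∈ D, HasStrictDerivAt τ (G H 0 1 η ^ 2) η := fun η hη => by
    refine intervalIntegral.integral_hasStrictDerivAt_right ?_
      (hKc.stronglyMeasurableAtFilter isOpen_Ioo η hη) (hKc.continuousAt (isOpen_Ioo.mem_nhds hη))
    exact ContinuousOn.intervalIntegrable (hKc.mono (OrdConnected.uIcc_subset ordConnected_Ioo h0D hη))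
  have cτ : ContinuousOn τ D := fun η hη =>
    (dτ η hη).hasDerivAt.continuousAt.continuousWithinAt
  have mτ : StrictMonoOn τ D := by
    refine strictMonoOn_of_deriv_pos (convex_Ioo _ _) cτ fun η hη => ?_
    rw [interior_Ioo] at hη
    rw [(dτ η hη).hasDerivAt.deriv]
    exact pow_pos (P.G_one_pos hη) 2
  have hsub : Ioo 0 (1 / M) ⊆ D := Ioo_subset_Ioo_left (neg_lt_zero.2 hδ).le
  -- Near `1 / M` one has `K_0 < (c + 1) (-ln (1 / M - η))`, so adding `(c + 1)²` times the
  -- convergent tail integral of `ln²` to `τ` gives a nonincreasing function, which bounds `τ`.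
  have hbdd : BddAbove (τ '' Ioo 0 (1 / M)) := by
    have hev : ∀ᶠ η in 𝓝[<] (1 / M), G H 0 1 η / -Real.log (1 / M - η) < c + 1 ∧
        0 < -Real.log (1 / M - η) ∧ η ∈ Ioo 0 (1 / M) :=
      (p.tendsto_G_zero.eventually_lt_const (lt_add_one c)).and
        (((tendsto_neg_log_sub (1 / M)).eventually_gt_atTop 0).and (Ioo_mem_nhdsLT hM'))
    obtain ⟨l, hl, hlsub⟩ := (mem_nhdsLT_iff_exists_Ioo_subset' hM').1 hev
    obtain ⟨η₁, hη₁⟩ := nonempty_Ioo.2 (mem_Iio.1 hl)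
    set L : ℝ → ℝ := fun η => ∫ μ in η..(1 / M), Real.log (1 / M - μ) ^ 2 with hL
    have hd : ∀ η ∈ Ico η₁ (1 / M), HasDerivAt (fun η => τ η + (c + 1) ^ 2 * L η)
        (G H 0 1 η ^ 2 + (c + 1) ^ 2 * -Real.log (1 / M - η) ^ 2) η := fun η hη =>
      (dτ η (hsub (hlsub ⟨hη₁.1.trans_le hη.1, hη.2⟩).2.2)).hasDerivAt.add
        ((hasDerivAt_integral_log_sub_sq hη.2).const_mul _)
    have hanti : AntitoneOn (fun η => τ η + (c + 1) ^ 2 * L η) (Ico η₁ (1 / M)) := by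
      refine antitoneOn_of_deriv_nonpos (convex_Ico _ _)
        (fun η hη => (hd η hη).continuousAt.continuousWithinAt)
        (fun η hη => (hd η (interior_subset hη)).differentiableAt.differentiableWithinAt)
        fun η hη => ?_
      have hη' := interior_subset hη
      rw [(hd η hη').deriv]
      obtain ⟨h1, h2, h3⟩ := hlsub ⟨hη₁.1.trans_le hη'.1, hη'.2⟩
      have h4 := (div_lt_iff₀ h2).1 h1
      have h5 := pow_le_pow_left₀ (P.G_one_pos (hsub h3)).le h4.le 2
      rw [mul_pow, neg_sq] at h5
      linarith
    refine ⟨τ η₁ + (c + 1) ^ 2 * L η₁, ?_⟩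
    rintro _ ⟨η, hη, rfl⟩
    have hL1 := integral_log_sub_sq_pos hη₁.2
    rcases le_total η η₁ with h | h
    · have h1 := mτ.monotoneOn (hsub hη) (hsub (hlsub hη₁).2.2) h
      have h2 : 0 ≤ (c + 1) ^ 2 * L η₁ := mul_nonneg (sq_nonneg _) hL1.le
      linarith
    · have h1 := hanti (left_mem_Ico.2 hη₁.2) ⟨h, hη.2⟩ h
      have h2 : 0 ≤ (c + 1) ^ 2 * L η :=
        mul_nonneg (sq_nonneg _) (integral_log_sub_sq_pos hη.2).le
      simp only at h1
      linarith
  set T := sSup (τ '' Ioo 0 (1 / M)) with hT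
  have tτ : Tendsto τ (𝓝[<] (1 / M)) (𝓝 T) :=
    MonotoneOn.tendsto_nhdsWithin_Ioo_left (nonempty_Ioo.2 hM') (mτ.monotoneOn.mono hsub) hbdd
  have hlt : ∀ η ∈ D, τ η < T := fun η hη => by
    obtain ⟨η', h1, h2⟩ := exists_between (max_lt hη.2 hM')
    have hη' : η' ∈ Ioo 0 (1 / M) := ⟨(le_max_right _ _).trans_lt h1, h2⟩
    exact (mτ hη (hsub hη') ((le_max_left _ _).trans_lt h1)).trans_le
      (le_csSup hbdd (mem_image_of_mem _ hη'))
  -- Any negative point of `D` would do: it provides a starting time before `0`.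
  have hδD : -(δ / 2) ∈ D := ⟨by linarith, by linarith⟩
  set e : ℝ → ℝ := Function.invFunOn τ D with he
  have he_left : ∀ η ∈ D, e (τ η) = η := fun η hη => mτ.injOn.leftInvOn_invFunOn hη
  have hsurj : ∀ t ∈ Ioo (τ (-(δ / 2))) T, ∃ η ∈ D, τ η = t := fun t ht => by
    obtain ⟨_, ⟨η, hη, rfl⟩, h1⟩ := exists_lt_of_lt_csSup
      ((nonempty_Ioo.2 hM').image τ) ht.2
    have hle : -(δ / 2) ≤ η := by linarith [hη.1]
    have hs : Icc (-(δ / 2)) η ⊆ D := OrdConnected.out ordConnected_Ioo hδD (hsub hη)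
    obtain ⟨x, hx, hxt⟩ := intermediate_value_Icc hle (cτ.mono hs) ⟨ht.1.le, h1.le⟩
    exact ⟨x, hs hx, hxt⟩
  have he_mem : ∀ t ∈ Ioo (τ (-(δ / 2))) T, e t ∈ D := fun t ht =>
    Function.invFunOn_mem (hsurj t ht)
  have he_right : ∀ t ∈ Ioo (τ (-(δ / 2))) T, τ (e t) = t := fun t ht =>
    Function.invFunOn_eq (hsurj t ht)
  have ht₀ : τ (-(δ / 2)) < 0 := hτ0 ▸ mτ hδD h0D (by linarith)
  have hT0 : 0 < T := hτ0 ▸ hlt 0 h0D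
  have he0 : e 0 = 0 := by
    have := he_left 0 h0D
    rwa [hτ0] at this
  have hclock : IsClock H D (τ (-(δ / 2))) T e :=
    { neg := ht₀
      mem := he_mem
      zero := he0
      hasDerivAt := fun t ht => by
        have hm := he_mem t ht
        have h := HasStrictDerivAt.to_local_left_inverse (dτ _ hm)
          (pow_pos (P.G_one_pos hm) 2).ne' (g := e) (by
            filter_upwards [isOpen_Ioo.mem_nhds hm] with η hη using he_left η hη)
        rw [he_right t ht] at h
        exact h.hasDerivAt }
  have hgt : ∀ η ∈ D, ∀ t ∈ Ioo (τ (-(δ / 2))) T, τ η < t → η < e t := fun η hη t ht h => by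
    by_contra! hle
    have := mτ.monotoneOn (he_mem t ht) hη hle
    rw [he_right t ht] at this
    linarith
  have te : Tendsto e (𝓝[<] T) (𝓝[<] (1 / M)) := by
    have hev : ∀ᶠ t in 𝓝[<] T, t ∈ Ioo (τ (-(δ / 2))) T := Ioo_mem_nhdsLT (ht₀.trans hT0)
    refine tendsto_nhdsWithin_iff.2 ⟨tendsto_order.2 ⟨fun a ha => ?_, fun b hb => ?_⟩, ?_⟩
    · have hm : max a 0 ∈ D := ⟨(neg_lt_zero.2 hδ).trans_le (le_max_right _ _), max_lt ha hM'⟩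
      filter_upwards [hev, Ioo_mem_nhdsLT (hlt _ hm)] with t ht ht'
      exact (le_max_left _ _).trans_lt (hgt _ hm t ht ht'.1)
    · filter_upwards [hev] with t ht using (he_mem t ht).2.trans hb
    · filter_upwards [hev] with t ht using (he_mem t ht).2
  refine ⟨τ (-(δ / 2)), T, e, hT0, hclock, fun t ht => ?_, te, ?_⟩
  · rcases ht.1.eq_or_lt with h | h
    · rw [← h, he0]
    · exact (hgt 0 h0D t (hclock.Ico_subset ht) (by rwa [hτ0])).le
  -- By l'Hôpital's rule the limit is that of `K_0² / ln²`, namely `c²`.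
  have hratio : Tendsto (fun η => (T - τ η) / ∫ μ in η..(1 / M), Real.log (1 / M - μ) ^ 2)
      (𝓝[<] (1 / M)) (𝓝 (c ^ 2)) := by
    have hevD : ∀ᶠ η in 𝓝[<] (1 / M), η ∈ D := Ioo_mem_nhdsLT ((neg_lt_zero.2 hδ).trans hM')
    refine HasDerivAt.lhopital_zero_nhdsLT (f' := fun η => -G H 0 1 η ^ 2)
      (g' := fun η => -Real.log (1 / M - η) ^ 2) ?_ ?_ ?_ ?_ (tendsto_integral_log_sub_sq _) ?_
    · filter_upwards [hevD] with η hη using (dτ η hη).hasDerivAt.const_sub T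
    · filter_upwards [hevD] with η hη using hasDerivAt_integral_log_sub_sq hη.2
    · filter_upwards [(tendsto_neg_log_sub (1 / M)).eventually_gt_atTop 0] with η hη
      exact neg_ne_zero.2 (pow_ne_zero 2 (neg_ne_zero.1 hη.ne'))
    · simpa using tτ.const_sub T
    · refine (p.tendsto_G_zero.pow 2).congr fun η => ?_
      rw [div_pow, neg_sq, neg_div_neg_eq]
  have hev : ∀ᶠ t in 𝓝[<] T, t ∈ Ioo (τ (-(δ / 2))) T := Ioo_mem_nhdsLT (ht₀.trans hT0)
  have hpos : ∀ᶠ t in 𝓝[<] T, 0 < ∫ μ in (e t)..(1 / M), Real.log (1 / M - μ) ^ 2 := by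
    filter_upwards [hev] with t ht using integral_log_sub_sq_pos (he_mem t ht).2
  rw [isEquivalent_iff_tendsto_one (by
    filter_upwards [hpos] with t ht using (mul_pos (pow_pos hc0 2) ht).ne')]
  have h1 := (hratio.comp te).div_const (c ^ 2)
  rw [div_self (pow_pos hc0 2).ne'] at h1
  refine h1.congr' ?_
  filter_upwards [hev] with t ht
  simp only [Function.comp_apply, Pi.div_apply]
  rw [he_right t ht, div_div, mul_comm]

/-- The derivative `u_x` along the trajectory of a maximum point, in rescaled time. -/
lemma isEquivalent_max :
    (fun η => (M / (1 - η * M) - G H 1 1 η / G H 0 1 η) / G H 0 1 η ^ 2) ~[𝓝[<] (1 / M)]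
      fun η => 1 / (M * ∑ b ∈ A, 1 / |dI H b|) ^ 2 *
        (1 / ((1 / M - η) * Real.log (1 / M - η) ^ 2)) := by
  set c := M * ∑ b ∈ A, 1 / |dI H b| with hc
  have hc0 : 0 < c := mul_pos p.pos p.sum_pos
  have hM := p.pos
  have hev : ∀ᶠ η in 𝓝[<] (1 / M), 0 < 1 / M - η ∧ 0 < -Real.log (1 / M - η) ∧ 0 < G H 0 1 η := by
    filter_upwards [self_mem_nhdsWithin, (tendsto_neg_log_sub (1 / M)).eventually_gt_atTop 0,
      p.tendsto_G_zero_atTop.eventually_gt_atTop 0] with η h1 h2 h3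
    exact ⟨sub_pos.2 (mem_Iio.1 h1), h2, h3⟩
  rw [isEquivalent_iff_tendsto_one (by
    filter_upwards [hev] with η hη
    have := neg_ne_zero.1 hη.2.1.ne'
    have := hη.1.ne'
    positivity)]
  -- Since `M / (1 - η M) = 1 / ε` with `ε = 1 / M - η`, the ratio is `c² (ln ε / K_0)² (1 - ε K_1 /
  -- K_0)`, where `ε K_1` converges and `K_0` diverges.
  have h1 := ((p.tendsto_G_zero.inv₀ hc0.ne').pow 2).mul
    ((p.tendsto_G_one.div_atTop p.tendsto_G_zero_atTop).const_sub 1) |>.const_mul (c ^ 2)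
  have e1 : c ^ 2 * (c⁻¹ ^ 2 * (1 - 0)) = 1 := by field_simp; ring
  rw [e1] at h1
  refine h1.congr' ?_
  filter_upwards [hev] with η ⟨h2, h3, h4⟩
  have hJ : 1 - η * M = M * (1 / M - η) := by field_simp
  simp only [Pi.div_apply]
  rw [hJ]
  have := neg_ne_zero.1 h3.ne'
  generalize 1 / M - η = ε at *
  generalize Real.log ε = x at *
  field_simp

/-- The derivative `u_x` along any other trajectory, in rescaled time. -/
lemma isEquivalent_lt {h : ℝ} (hh : h < M) :
    (fun η => (h / (1 - η * h) - G H 1 1 η / G H 0 1 η) / G H 0 1 η ^ 2) ~[𝓝[<] (1 / M)]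
      fun η => 1 / (M * ∑ b ∈ A, 1 / |dI H b|) ^ 2 *
        (1 / ((1 / M - η) * Real.log (1 / M - η) ^ 3)) := by
  set c := M * ∑ b ∈ A, 1 / |dI H b| with hc
  have hc0 : 0 < c := mul_pos p.pos p.sum_pos
  have hM := p.pos
  have hev : ∀ᶠ η in 𝓝[<] (1 / M), 0 < 1 / M - η ∧ 0 < -Real.log (1 / M - η) ∧ 0 < G H 0 1 η := by
    filter_upwards [self_mem_nhdsWithin, (tendsto_neg_log_sub (1 / M)).eventually_gt_atTop 0,
      p.tendsto_G_zero_atTop.eventually_gt_atTop 0] with η h1 h2 h3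
    exact ⟨sub_pos.2 (mem_Iio.1 h1), h2, h3⟩
  rw [isEquivalent_iff_tendsto_one (by
    filter_upwards [hev] with η hη
    have := neg_ne_zero.1 hη.2.1.ne'
    have := hη.1.ne'
    positivity)]
  have tη : Tendsto (fun η : ℝ => η) (𝓝[<] (1 / M)) (𝓝 (1 / M)) := nhdsWithin_le_nhds
  have hne : 1 - 1 / M * h ≠ 0 := by
    have : 1 / M * h < 1 := by rw [one_div_mul_eq_div]; exact (div_lt_one hM).2 hh
    linarith
  have tB : Tendsto (fun η => h / (1 - η * h)) (𝓝[<] (1 / M)) (𝓝 (h / (1 - 1 / M * h))) :=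
    tendsto_const_nhds.div ((tη.mul_const h).const_sub 1) hne
  -- The term with `h` is bounded, so multiplied by `ε ln ε` it vanishes; the limit comes from `-K_1
  -- / K_0³`, whose sign is carried by the odd power of `ln ε < 0`.
  have h1 := ((p.tendsto_G_zero.inv₀ hc0.ne').pow 2).mul
    ((p.tendsto_G_one.mul (p.tendsto_G_zero.inv₀ hc0.ne')).sub
      ((tendsto_sub_mul_log (1 / M)).mul tB)) |>.const_mul (c ^ 2)
  have e1 : c ^ 2 * (c⁻¹ ^ 2 * (c * c⁻¹ - 0 * (h / (1 - 1 / M * h)))) = 1 := by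
    field_simp; ring
  rw [e1] at h1
  refine h1.congr' ?_
  filter_upwards [hev] with η ⟨h2, h3, h4⟩
  simp only [Pi.div_apply]
  have := neg_ne_zero.1 h3.ne'
  generalize h / (1 - η * h) = B
  generalize 1 / M - η = ε at *
  generalize Real.log ε = x at *
  field_simp
  ring

end IsPeaked

end NonlocalBlowup

namespace NonlocalBlowup

/-! ### The blow-up theorem -/

lemma enorm_le_eLpNorm_top {f : ℝ → ℝ} (hf : ContinuousOn f (Icc 0 1)) {a : ℝ}
    (ha : a ∈ Icc (0 : ℝ) 1) : ‖f a‖ₑ ≤ eLpNorm f ∞ (volume.restrict (Icc (0 : ℝ) 1)) := by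
  rw [eLpNorm_exponent_top]
  set C := eLpNormEssSup f (volume.restrict (Icc (0 : ℝ) 1)) with hC
  -- The almost everywhere bound is recast as an equality of continuous functions, which then holds
  -- at every point of the interval.
  have hae : (fun x => max ‖f x‖ₑ C) =ᵐ[volume.restrict (Icc (0 : ℝ) 1)] fun _ => C := by
    filter_upwards [enorm_ae_le_eLpNormEssSup f (volume.restrict (Icc (0 : ℝ) 1))] with x hx
    exact max_eq_right hx
  have h := Measure.eqOn_Icc_of_ae_eq volume zero_ne_one hae
    (hf.enorm.sup continuousOn_const) continuousOn_const ha
  exact max_eq_right_iff.1 h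

/-- The extension of `u₀'` from `[0,1]` by constants. -/
noncomputable def profile (u₀ : ℝ → ℝ) : ℝ → ℝ :=
  fun x => dI u₀ (projIcc (0 : ℝ) 1 zero_le_one x)

lemma profile_eq (u₀ : ℝ → ℝ) {x : ℝ} (hx : x ∈ Icc (0 : ℝ) 1) : profile u₀ x = dI u₀ x := by
  rw [profile, projIcc_of_mem zero_le_one hx]

lemma dI_profile (u₀ : ℝ → ℝ) {x : ℝ} (hx : x ∈ Icc (0 : ℝ) 1) :
    dI (profile u₀) x = dI (dI u₀) x :=
  derivWithin_congr (fun _ hy => profile_eq u₀ hy) (profile_eq u₀ hx)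

lemma contDiffOn_dI {u₀ : ℝ → ℝ} (hu₀ : ContDiffOn ℝ ∞ u₀ (Icc 0 1)) :
    ContDiffOn ℝ ∞ (dI u₀) (Icc 0 1) :=
  hu₀.derivWithin (uniqueDiffOn_Icc one_pos) (by simp)

lemma isPeaked_profile {u₀ : ℝ → ℝ} {M₀ : ℝ} {A : Finset ℝ} (hu₀ : ContDiffOn ℝ ∞ u₀ (Icc 0 1))
    (hM₀ : 0 < M₀) (hmax : IsGreatest (dI u₀ '' Icc 0 1) M₀)
    (hA : ∀ α, α ∈ A ↔ α ∈ Icc (0 : ℝ) 1 ∧ dI u₀ α = M₀)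
    (hconc : ∀ a ∈ A, dI (dI u₀) a ≠ 0) : IsPeaked (profile u₀) M₀ A where
  pos := hM₀
  cont := (contDiffOn_dI hu₀).continuousOn.comp_continuous
    (continuous_subtype_val.comp continuous_projIcc) fun x => (projIcc 0 1 zero_le_one x).2
  smooth := (contDiffOn_dI hu₀).congr fun x hx => profile_eq u₀ hx
  le s hs := by
    rw [profile_eq u₀ hs]
    exact hmax.2 (mem_image_of_mem _ hs)
  mem_iff a := by
    rw [hA]
    exact and_congr_right fun ha => by rw [profile_eq u₀ ha]
  nonempty := by
    obtain ⟨a, ha, haM⟩ := hmax.1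
    exact ⟨a, (hA a).2 ⟨ha, haM⟩⟩
  deriv_ne a ha := by
    rw [dI_profile u₀ ((hA a).1 ha).1]
    exact hconc a ha

lemma exists_isProfile {u₀ : ℝ → ℝ} {M₀ : ℝ} {A : Finset ℝ} (hu₀ : ContDiffOn ℝ ∞ u₀ (Icc 0 1))
    (p : IsPeaked (profile u₀) M₀ A) :
    ∃ δ, 0 < δ ∧ IsProfile (profile u₀) (Ioo (-δ) (1 / M₀)) := by
  obtain ⟨B, hB⟩ := isCompact_Icc.exists_bound_of_continuousOn (contDiffOn_dI hu₀).continuousOn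
  have hB0 : 0 ≤ B := (norm_nonneg _).trans (hB 0 (by simp))
  have hδ : 0 < 1 / (B + 1) := by positivity
  -- For `η ≥ 0` the maximum of `H` controls positivity; for `η < 0` the bound `B` on `|u₀'|` does,
  -- through `|η| B < 1`.
  refine ⟨1 / (B + 1), hδ, p.cont, p.smooth, isOpen_Ioo, fun η hη s => ?_⟩
  set x := projIcc (0 : ℝ) 1 zero_le_one s with hx
  have hs : profile u₀ s = profile u₀ x := (profile_eq u₀ x.2).symm
  rcases le_total 0 η with h | h
  · rw [hs]
    exact p.one_sub_pos ⟨h, hη.2⟩ x.2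
  · have h1 : |dI u₀ x| ≤ B := hB x x.2
    have h2 : -η * (B + 1) < 1 := (lt_div_iff₀ (by positivity)).1 (by linarith [hη.1])
    have h3 : -η * -B ≤ -η * dI u₀ x :=
      mul_le_mul_of_nonneg_left (abs_le.1 h1).1 (by linarith)
    rw [profile, ← hx]
    nlinarith

/-- Monotonicity of `h ↦ h / (1 - η h)` keeps the maximum of `u_x` on the trajectories where `u₀'`
is maximal. -/
lemma div_one_sub_mul_le_div_one_sub_mul {η h M : ℝ} (hη : 0 ≤ η) (hh : h ≤ M) (hM : 0 < 1 - η * M) :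
    h / (1 - η * h) ≤ M / (1 - η * M) := by
  have h1 : 0 < 1 - η * h := by nlinarith
  rw [div_le_div_iff₀ h1 hM]
  nlinarith

end NonlocalBlowup

theorem theorem3p1 (u₀ : ℝ → ℝ) (M₀ : ℝ) (A : Finset ℝ)
    (hu₀ : ContDiffOn ℝ ∞ u₀ (Icc 0 1))
    (hbc : u₀ 0 = 0 ∧ u₀ 1 = 0)
    (hM₀ : 0 < M₀)
    (hmax : IsGreatest (NonlocalBlowup.dI u₀ '' Icc 0 1) M₀)
    -- `A` is the set of all points where `u₀'` attains `M₀`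
    (hA : ∀ α, α ∈ A ↔ α ∈ Icc (0 : ℝ) 1 ∧ NonlocalBlowup.dI u₀ α = M₀)
    (hconc : ∀ a ∈ A, NonlocalBlowup.dI (NonlocalBlowup.dI u₀) a ≠ 0) :
    (∀ a ∈ A, a = 0 ∨ a = 1) ∧
    ∃ tstar : ℝ, 0 < tstar ∧ ∃ u : ℝ → ℝ → ℝ,
      -- `u` is the smooth solution, with maximal existence time `tstar`
      NonlocalBlowup.IsSmoothSolution u₀ tstar u ∧
      (∀ (T : ℝ) (v : ℝ → ℝ → ℝ), NonlocalBlowup.IsSmoothSolution u₀ T v →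
        T ≤ tstar ∧ ∀ x ∈ Icc (0 : ℝ) 1, ∀ t ∈ Ico 0 T, v x t = u x t) ∧
      -- `u_x` blows up in `L^∞[0,1]`
      Tendsto (fun t => eLpNorm (fun x => NonlocalBlowup.ux u x t) ∞
        (volume.restrict (Icc (0 : ℝ) 1))) (𝓝[<] tstar) (𝓝 ∞) ∧
      ∃ (γ : ℝ → ℝ → ℝ) (η : ℝ → ℝ),
        NonlocalBlowup.IsFlow tstar u γ ∧
        NonlocalBlowup.IsRescaledTime tstar u η ∧
        (∀ t ∈ Ico 0 tstar, 0 ≤ η t ∧ η t < 1 / M₀) ∧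
        Tendsto η (𝓝[<] tstar) (𝓝 (1 / M₀)) ∧
        -- the maximum of `u_x` is attained at the points of `A` and tends to `+∞`
        (∀ a ∈ A,
          (∀ t ∈ Ico 0 tstar, γ a t = a ∧
            IsGreatest ((fun α => NonlocalBlowup.ux u (γ α t) t) '' Icc 0 1)
              (NonlocalBlowup.ux u a t)) ∧
          Tendsto (fun t => NonlocalBlowup.ux u a t) (𝓝[<] tstar) atTop ∧
          (fun t => NonlocalBlowup.ux u a t) ~[𝓝[<] tstar] (fun t =>
            1 / (M₀ * ∑ b ∈ A, 1 / |NonlocalBlowup.dI (NonlocalBlowup.dI u₀) b|) ^ 2 *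
              (1 / ((1 / M₀ - η t) * Real.log (1 / M₀ - η t) ^ 2)))) ∧
        -- along every other trajectory `u_x` tends to `-∞`
        (∀ α ∈ Icc (0 : ℝ) 1, α ∉ A →
          Tendsto (fun t => NonlocalBlowup.ux u (γ α t) t) (𝓝[<] tstar) atBot ∧
          (fun t => NonlocalBlowup.ux u (γ α t) t) ~[𝓝[<] tstar] (fun t =>
            1 / (M₀ * ∑ b ∈ A, 1 / |NonlocalBlowup.dI (NonlocalBlowup.dI u₀) b|) ^ 2 *
              (1 / ((1 / M₀ - η t) * Real.log (1 / M₀ - η t) ^ 3)))) ∧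
        -- the relation between `tstar - t` and `1 / M₀ - η`
        (fun t => tstar - t) ~[𝓝[<] tstar] (fun t =>
          (M₀ * ∑ b ∈ A, 1 / |NonlocalBlowup.dI (NonlocalBlowup.dI u₀) b|) ^ 2 *
            ∫ μ in (η t)..(1 / M₀), Real.log (1 / M₀ - μ) ^ 2) := by
  open NonlocalBlowup in
  have p := isPeaked_profile hu₀ hM₀ hmax hA hconc
  obtain ⟨δ, hδ, P⟩ := exists_isProfile hu₀ p
  obtain ⟨t₀, T, e, hT, c, he0, te, hequiv⟩ := p.exists_isClock hδ P
  have hS : ∑ b ∈ A, 1 / |dI (profile u₀) b| = ∑ b ∈ A, 1 / |dI (dI u₀) b| :=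
    Finset.sum_congr rfl fun b hb => by rw [dI_profile u₀ ((hA b).1 hb).1]
  have hsol := c.isSmoothSolution P hu₀ hbc.1 hbc.2 (fun x hx => profile_eq u₀ hx) hT
  have hG0 : G (profile u₀) 1 1 0 = 0 := by
    rw [G_one_zero hu₀ hbc.1 (fun x hx => profile_eq u₀ hx) (right_mem_Icc.2 zero_le_one), hbc.2]
  have hc0 : 0 < 1 / (M₀ * ∑ b ∈ A, 1 / |dI (profile u₀) b|) ^ 2 :=
    one_div_pos.2 (pow_pos (mul_pos p.pos p.sum_pos) 2)
  have hev : ∀ᶠ t in 𝓝[<] T, t ∈ Ioo t₀ T := Ioo_mem_nhdsLT (c.neg.trans hT)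
  have hflow : ∀ a ∈ A, ∀ t ∈ Ico 0 T, flow (profile u₀) a (e t) = a := fun a ha t ht => by
    rcases p.eq_zero_or_one ha with rfl | rfl
    · exact IsProfile.flow_zero _
    · exact P.flow_one (c.mem t (c.Ico_subset ht))
  have hev' : ∀ᶠ t in 𝓝[<] T, t ∈ Ico 0 T := Ico_mem_nhdsLT hT
  have hmaxeq : ∀ a ∈ A, (fun t => ux (sol (profile u₀) e) a t) ~[𝓝[<] T] (fun t =>
      1 / (M₀ * ∑ b ∈ A, 1 / |dI (profile u₀) b|) ^ 2 *
        (1 / ((1 / M₀ - e t) * Real.log (1 / M₀ - e t) ^ 2))) := fun a ha => by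
    refine (p.isEquivalent_max.comp_tendsto te).congr_left ?_
    filter_upwards [hev'] with t ht
    have h := c.ux_sol_flow P ((hA a).1 ha).1 (c.Ico_subset ht)
    rw [hflow a ha t ht, ((p.mem_iff a).1 ha).2] at h
    exact h.symm
  have htop : ∀ a ∈ A, Tendsto (fun t => ux (sol (profile u₀) e) a t) (𝓝[<] T) atTop :=
    fun a ha => (hmaxeq a ha).symm.tendsto_atTop (by
      have h := ((tendsto_one_div_mul_log_pow (1 / M₀) 2).comp te).const_mul_atTop hc0
      simpa only [Function.comp_apply, neg_sq] using! h)
  obtain ⟨a₀, ha₀⟩ := p.nonempty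
  refine ⟨fun a ha => p.eq_zero_or_one ha, T, hT, sol (profile u₀) e, hsol, fun T' v hv => ?_, ?_,
    fun α t => flow (profile u₀) α (e t), e, c.isFlow P, c.isRescaledTime P hG0,
    fun t ht => ⟨he0 t ht, (c.mem t (c.Ico_subset ht)).2⟩,
    te.mono_right nhdsWithin_le_nhds, fun a ha => ⟨fun t ht => ⟨hflow a ha t ht, ?_⟩, htop a ha, ?_⟩,
    fun α hα hαA => ?_, ?_⟩
  · have hT' : T' ≤ T := by
      by_contra! hlt
      -- A solution living past `T` would have `v_x(a₀, ·)` continuous at `T`, yet by uniqueness it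
      -- agrees before `T` with a function tending to `+∞`.
      have heq : ∀ t ∈ Ico 0 T, ux v a₀ t = ux (sol (profile u₀) e) a₀ t := fun t ht =>
        derivWithin_congr (fun x hx => hsol.eqOn (hv.mono hlt.le) hx ht)
          (hsol.eqOn (hv.mono hlt.le) ((hA a₀).1 ha₀).1 ht)
      have hcont : ContinuousOn (fun t => ux v a₀ t) (Ico 0 T') :=
        (contDiffOn_ux hv.smooth (uniqueDiffOn_Ico 0 T')).continuousOn.comp
          (f := fun t : ℝ => ((a₀, t) : ℝ × ℝ)) (by fun_prop) fun t ht => ⟨((hA a₀).1 ha₀).1, ht⟩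
      have h1 := (hcont.continuousAt (Ico_mem_nhds hT hlt)).tendsto.mono_left
        (nhdsWithin_le_nhds (s := Iio T))
      refine not_tendsto_nhds_of_tendsto_atTop ((htop a₀ ha₀).congr' ?_) _ h1
      filter_upwards [hev'] with t ht using (heq t ht).symm
    exact ⟨hT', fun x hx t ht => (hsol.mono hT').eqOn hv hx ht⟩
  · refine tendsto_nhds_top_mono (ENNReal.tendsto_ofReal_atTop.comp (htop a₀ ha₀)) ?_
    filter_upwards [hev'] with t ht
    refine le_trans ?_ (enorm_le_eLpNorm_top (continuousOn_slice
      (contDiffOn_ux hsol.smooth (uniqueDiffOn_Ico 0 T)) ht) ((hA a₀).1 ha₀).1)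
    rw [← ofReal_norm]
    exact ENNReal.ofReal_le_ofReal (le_abs_self _)
  · have ht' := c.Ico_subset ht
    have haM := ((p.mem_iff a).1 ha)
    have hJ : 0 < 1 - e t * M₀ := haM.2 ▸ P.pos _ (c.mem t ht') a
    refine ⟨⟨a, haM.1, ?_⟩, ?_⟩
    · simp only [hflow a ha t ht]
    · rintro _ ⟨α, hα, rfl⟩
      have h := c.ux_sol_flow P haM.1 ht'
      rw [hflow a ha t ht, haM.2] at h
      simp only [h, c.ux_sol_flow P hα ht']
      exact div_le_div_of_nonneg_right (sub_le_sub_right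
        (div_one_sub_mul_le_div_one_sub_mul (he0 t ht) (p.le α hα) hJ) _) (sq_nonneg _)
  · rw [← hS]
    exact hmaxeq a ha
  · have hlt : profile u₀ α < M₀ := lt_of_le_of_ne (p.le α hα) fun h =>
      hαA ((p.mem_iff α).2 ⟨hα, h⟩)
    have hequivα : (fun t => ux (sol (profile u₀) e) (flow (profile u₀) α (e t)) t) ~[𝓝[<] T]
        (fun t => 1 / (M₀ * ∑ b ∈ A, 1 / |dI (profile u₀) b|) ^ 2 *
          (1 / ((1 / M₀ - e t) * Real.log (1 / M₀ - e t) ^ 3))) := by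
      refine ((p.isEquivalent_lt hlt).comp_tendsto te).congr_left ?_
      filter_upwards [hev'] with t ht using (c.ux_sol_flow P hα (c.Ico_subset ht)).symm
    refine ⟨hequivα.symm.tendsto_atBot ?_, hS ▸ hequivα⟩
    have h := tendsto_neg_atTop_atBot.comp
      (((tendsto_one_div_mul_log_pow (1 / M₀) 3).comp te).const_mul_atTop hc0)
    refine h.congr fun t => ?_
    simp only [Function.comp_apply]
    rw [Odd.neg_pow (by decide), mul_neg, div_neg, mul_neg, neg_neg]
  · rw [← hS]
    exact hequiv
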